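/- **Theorem (Discrete-continuous convergence).** Let $d\ge 1$, $T>0$. For $N\in\mathbb N$, $N\ge1$, let $\mathcal M_1^N(\mathbb R^d)$ be the set of positive Borel measures on $\mathbb R^d$ with total mass $N$ and finite first moment, with the 1-Wasserstein distance $$W_1(\mu,\nu)=\inf_{\pi\in\Pi(\mu,\nu)}\int_{\mathbb R^d\times\mathbb R^d}|x-y|\,d\pi(x,y),$$ where $\Pi(\mu,\nu)$ is the set of measures on $\mathbb R^d\times\mathbb R^d$ with marginals $\mu,\nu$. Let $v_{\mathrm d},\mathcal K:\mathbb R^d\to\mathbb R^d$ be Lipschitz continuous, let $\alpha,\beta\in\mathbb R$ with $\alpha+\beta\ge1$, and put $$K^N_{\alpha,\beta}(z)=\frac1{N^\alpha}\,\mathcal K\!\left(\frac z{N^\beta}\right),\qquad v^N[\mu](x)=v_{\mathrm d}(x)-\int_{\mathbb R^d}K^N_{\alpha,\beta}(y-x)\,d\mu(y).$$ A solution of the Cauchy problem $$\partial_t\mu_t+\operatorname{div}(\mu_t\,v^N[\mu_t])=0\ \text{ on }(0,T]\times\mathbb R^d,\qquad \mu_0=\bar\mu,$$ is a $W_1$-continuous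 curve $\mu_\cdot\in C([0,T];\mathcal M_1^N(\mathbb R^d))$ with $\mu_0=\bar\mu$ such that for all $t\in[0,T]$ and $\phi\in C_c^\infty(\mathbb R^d)$ $$\int_{\mathbb R^d}\phi\,d\mu_t=\int_{\mathbb R^d}\phi\,d\mu_0+\int_0^t\int_{\mathbb R^d}\nabla\phi\cdot v^N[\mu_s]\,d\mu_s\,ds .$$ Let $f:\mathbb R^d\to\mathbb R$ be nonnegative with $\operatorname{supp}f\subseteq\overline{B_1(0)}$ and $\int_{B_1(0)}f\,dx=1$. For every $N\ge1$ let $\bar X^{N,1},\dots,\bar X^{N,N}\in\mathbb R^d$ be distinct points, let $r=r_N>0$ satisfy $r_N<\frac12\min_{i\ne j}|\bar X^{N,j}-\bar X^{N,i}|$ (no condition if $N=1$), and set $$\bar\epsilon^N=\sum_{i=1}^N\delta_{\bar X^{N,i}},\qquad \bar\rho^N(x)=\sum_{i=1}^N\frac1{r_N^d}\,f\!\left(\frac{x-\bar X^{N,i}}{r_N}\right),$$ where $\bar\rho^N$ is identified with the measure having this density. Let $\epsilon^N_\cdot$ and $\rho^N_\cdot$ be solutions of the Cauchy problem with initial data $\bar\epsilon^N$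 and $\bar\rho^N$, respectively. If $r_N=o(1/N)$ as $N\to\infty$, then $$\lim_{N\to\infty}W_1(\epsilon^N_t,\rho^N_t)=0\qquad\text{for every }t\in(0,T].$$ -/

import Mathlib

open Set Filter Topology MeasureTheory Asymptotics
open scoped NNReal ENNReal ContDiff

noncomputable section

namespace CrowdDynamics

/-- The state space `ℝ^d` with the Euclidean norm and its Borel σ-algebra. -/
abbrev Space (d : ℕ) : Type := EuclideanSpace ℝ (Fin d)

/-- The transference plans between `μ` and `ν`: measures on the product with marginals `μ`, `ν`. -/
def transferencePlans {d : ℕ} (μ ν : Measure (Space d)) : Set (Measure (Space d × Space d)) :=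
  {π | π.map Prod.fst = μ ∧ π.map Prod.snd = ν}

/-- The 1-Wasserstein distance, as the infimum of the transport costs `∫ |x - y| dπ(x, y)`.
It takes values in `[0, ∞]`, and is finite on measures of equal mass and finite first moment. -/
def W1 {d : ℕ} (μ ν : Measure (Space d)) : ℝ≥0∞ :=
  ⨅ π ∈ transferencePlans μ ν, ∫⁻ p, ENNReal.ofReal ‖p.1 - p.2‖ ∂π

/-- `𝓜₁^N(ℝ^d)`: the positive Borel measures with total mass `N` and finite first moment. -/
def massMeasures (d N : ℕ) : Set (Measure (Space d)) :=
  {μ | μ univ = (N : ℝ≥0∞) ∧ ∫⁻ x, ENNReal.ofReal ‖x‖ ∂μ < ⊤}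

/-- The transport velocity `v[μ](x) = v_d(x) - ∫ K(y - x) dμ(y)`. -/
def velocity {d : ℕ} (vd K : Space d → Space d) (μ : Measure (Space d)) (x : Space d) : Space d :=
  vd x - ∫ y, K (y - x) ∂μ

/-- `μ ∈ C([0,T]; 𝓜₁^N(ℝ^d))`, where `𝓜₁^N(ℝ^d)` is metrized by `W1`, is a weak solution of
`∂ₜ μₜ + div (μₜ v[μₜ]) = 0` on `(0,T]` with initial datum `μ₀`.
In the weak formulation `fderiv ℝ φ x w` is `∇φ(x) · w`. -/
structure IsSolution {d : ℕ} (N : ℕ) (T : ℝ) (vd K : Space d → Space d)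
    (μ₀ : Measure (Space d)) (μ : ℝ → Measure (Space d)) : Prop where
  mem : ∀ t ∈ Icc 0 T, μ t ∈ massMeasures d N
  continuous : ∀ s ∈ Icc 0 T, Tendsto (fun t => W1 (μ t) (μ s)) (𝓝[Icc 0 T] s) (𝓝 0)
  initial : μ 0 = μ₀
  weak : ∀ φ : Space d → ℝ, ContDiff ℝ ∞ φ → HasCompactSupport φ → ∀ t ∈ Icc 0 T,
    ∫ x, φ x ∂(μ t) = ∫ x, φ x ∂(μ 0) +
      ∫ s in (0 : ℝ)..t, ∫ x, fderiv ℝ φ x (velocity vd K (μ s) x) ∂(μ s)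

/-- The scaled interaction kernel `K^N_{α,β}(z) = N^{-α} 𝒦(z / N^β)`. -/
def scaledKernel {d : ℕ} (𝒦 : Space d → Space d) (α β : ℝ) (N : ℕ) (z : Space d) : Space d :=
  (1 / (N : ℝ) ^ α) • 𝒦 ((1 / (N : ℝ) ^ β) • z)

/-- The discrete crowd `∑ᵢ δ_{Xᵢ}`. -/
def discreteDatum {d N : ℕ} (X : Fin N → Space d) : Measure (Space d) :=
  ∑ i, Measure.dirac (X i)

/-- The continuous crowd with density `∑ᵢ r^{-d} f((x - Xᵢ) / r)`. -/
def continuousDatum {d N : ℕ} (f : Space d → ℝ) (r : ℝ) (X : Fin N → Space d) :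
    Measure (Space d) :=
  volume.withDensity fun x =>
    ENNReal.ofReal (∑ i, (1 / r ^ d) * f ((1 / r) • (x - X i)))

/-- A bump profile: nonnegative, supported in the closed unit ball, of unit mass. -/
structure IsProfile {d : ℕ} (f : Space d → ℝ) : Prop where
  nonneg : ∀ x, 0 ≤ f x
  support : tsupport f ⊆ Metric.closedBall 0 1
  mass : ∫ x in Metric.ball 0 1, f x = 1

end CrowdDynamics

end

/-!
Both solutions are push-forwards of their initial measures along characteristics, so the distance of
the initial data is propagated with a constant that does not depend on `N`.

*Uniformity in `N`.* Since `α + β ≥ 1`, the scaled kernel has Lipschitz constant at most `LK / N`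
(`exists_lipschitzWith_scaledKernel`). Hence the velocity generated by a measure of mass `N` is
`(Lv + LK)`-Lipschitz, and two such velocities differ by at most `LK / N` times the Wasserstein
distance of the measures (`norm_velocity_sub_velocity_le`).

*Representation.* A weak solution of `∂ₜ μ + div (μ b) = 0`, with `b` Lipschitz in space, is
transported by the flow of `b` (`IsWeakSolutionOn.eq_map`). To see this, fix a Lipschitz function `g`
of bounded support and let `u t x` be the value of `g` at the endpoint of the characteristic through
`(t, x)`. Formally `u` solves `∂ₜ u + b · ∇u = 0`, but it is only Lipschitz and cannot serve as a
test function. Its mollification at scale `δ` can, and it solves the transport equation up to an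
error `O(δ)`, because `b` varies by `O(δ)` over the support of the mollifier
(`IsLipschitzTransport.eventually_abs_mollify_sub_le`). Letting `δ → 0`, the integral of `u t`
against the solution is constant in time (`IsWeakSolutionOn.integral_eq`).

*Stability.* On a time interval so short that `(Lv + LK) (e - s) ≤ 1 / 4`, a transport plan is
carried along the two flows; Grönwall's inequality bounds its cost, and the contribution of the
nonlocal term is absorbed, which gives `W1_le_four_mul`. Chaining a number of short intervals that
depends only on `T` and `Lv + LK` gives `W1_le_four_pow_mul`.

*Initial data.* Collapsing each bump to its centre costs at most `r N`, so the initial distance is at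
most `N * r N` (`W1_discreteDatum_continuousDatum_le`), which tends to `0`.
-/

noncomputable section

namespace CrowdDynamics

/-! ### Transport plans and the velocity field -/

section Plans

variable {d : ℕ}

lemma isFiniteMeasure_of_mem_massMeasures {N : ℕ} {μ : Measure (Space d)}
    (hμ : μ ∈ massMeasures d N) : IsFiniteMeasure μ :=
  ⟨by rw [hμ.1]; exact ENNReal.natCast_lt_top N⟩

lemma real_univ_of_mem_massMeasures {N : ℕ} {μ : Measure (Space d)}
    (hμ : μ ∈ massMeasures d N) : μ.real univ = N := by
  simp [Measure.real, hμ.1]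

lemma integrable_norm_of_mem_massMeasures {N : ℕ} {μ : Measure (Space d)}
    (hμ : μ ∈ massMeasures d N) : Integrable (fun x => ‖x‖) μ := by
  refine ⟨by fun_prop, ?_⟩
  rw [hasFiniteIntegral_iff_norm]
  simpa using hμ.2

lemma integrable_of_lipschitzWith {N : ℕ} {μ : Measure (Space d)} (hμ : μ ∈ massMeasures d N)
    {g : Space d → Space d} {C : ℝ≥0} (hg : LipschitzWith C g) : Integrable g μ := by
  have := isFiniteMeasure_of_mem_massMeasures hμ
  refine Integrable.mono' ((integrable_const ‖g 0‖).add
    ((integrable_norm_of_mem_massMeasures hμ).const_mul (C : ℝ)))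
    hg.continuous.aestronglyMeasurable (ae_of_all _ fun x => ?_)
  have h := hg.norm_sub_le x 0
  rw [sub_zero] at h
  have := norm_le_norm_add_norm_sub' (g x) (g 0)
  simp only [Pi.add_apply]
  linarith

lemma transferencePlans_isFiniteMeasure {μ ν : Measure (Space d)} [IsFiniteMeasure μ]
    {π : Measure (Space d × Space d)} (hπ : π ∈ transferencePlans μ ν) : IsFiniteMeasure π := by
  refine ⟨?_⟩
  have h := measure_lt_top μ univ
  rwa [← hπ.1, Measure.map_apply measurable_fst MeasurableSet.univ, preimage_univ] at h

lemma integral_fst_of_mem_transferencePlans {F : Type*} [NormedAddCommGroup F] [NormedSpace ℝ F]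
    [SecondCountableTopology F] {μ ν : Measure (Space d)} {π : Measure (Space d × Space d)}
    (hπ : π ∈ transferencePlans μ ν) {g : Space d → F} (hg : Continuous g) :
    ∫ p, g p.1 ∂π = ∫ x, g x ∂μ := by
  rw [← hπ.1, integral_map measurable_fst.aemeasurable hg.aestronglyMeasurable]

lemma integral_snd_of_mem_transferencePlans {F : Type*} [NormedAddCommGroup F] [NormedSpace ℝ F]
    [SecondCountableTopology F] {μ ν : Measure (Space d)} {π : Measure (Space d × Space d)}
    (hπ : π ∈ transferencePlans μ ν) {g : Space d → F} (hg : Continuous g) :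
    ∫ p, g p.2 ∂π = ∫ x, g x ∂ν := by
  rw [← hπ.2, integral_map measurable_snd.aemeasurable hg.aestronglyMeasurable]

lemma integrable_fst_of_mem_transferencePlans {F : Type*} [NormedAddCommGroup F]
    [SecondCountableTopology F] {μ ν : Measure (Space d)} {π : Measure (Space d × Space d)}
    (hπ : π ∈ transferencePlans μ ν) {g : Space d → F} (hg : Continuous g) (hi : Integrable g μ) :
    Integrable (fun p : Space d × Space d => g p.1) π := by
  rw [← hπ.1] at hi
  exact (integrable_map_measure hg.aestronglyMeasurable measurable_fst.aemeasurable).1 hi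

lemma integrable_snd_of_mem_transferencePlans {F : Type*} [NormedAddCommGroup F]
    [SecondCountableTopology F] {μ ν : Measure (Space d)} {π : Measure (Space d × Space d)}
    (hπ : π ∈ transferencePlans μ ν) {g : Space d → F} (hg : Continuous g) (hi : Integrable g ν) :
    Integrable (fun p : Space d × Space d => g p.2) π := by
  rw [← hπ.2] at hi
  exact (integrable_map_measure hg.aestronglyMeasurable measurable_snd.aemeasurable).1 hi

lemma exists_plan_integral_le_of_W1_lt {μ ν : Measure (Space d)} {w : ℝ}
    (h : W1 μ ν < ENNReal.ofReal w) :
    ∃ π ∈ transferencePlans μ ν, Integrable (fun p : Space d × Space d => ‖p.1 - p.2‖) π ∧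
      ∫ p, ‖p.1 - p.2‖ ∂π ≤ w := by
  unfold W1 at h
  simp only [iInf_lt_iff] at h
  obtain ⟨π, hπ, hlt⟩ := h
  have hw : 0 ≤ w := by
    by_contra hw
    rw [ENNReal.ofReal_of_nonpos (by linarith)] at hlt
    exact not_lt_bot hlt
  refine ⟨π, hπ, ⟨by fun_prop, ?_⟩, ?_⟩
  · rw [hasFiniteIntegral_iff_norm]
    simpa using hlt.trans ENNReal.ofReal_lt_top
  · rw [integral_eq_lintegral_of_nonneg_ae (ae_of_all _ fun p => norm_nonneg _) (by fun_prop)]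
    exact ENNReal.toReal_le_of_le_ofReal hw hlt.le

lemma lipschitzWith_comp_sub {K : Space d → Space d} {k : ℝ≥0} (hK : LipschitzWith k K)
    (x : Space d) : LipschitzWith k fun y => K (y - x) := by
  simpa [Function.comp_def] using
    hK.comp ((LipschitzWith.id (α := Space d)).sub (LipschitzWith.const x))

lemma norm_velocity_sub_velocity_le {N : ℕ} {vd K : Space d → Space d} {k : ℝ≥0}
    (hK : LipschitzWith k K) {μ ν : Measure (Space d)} (hμ : μ ∈ massMeasures d N)
    (hν : ν ∈ massMeasures d N) {w : ℝ} (hw : 0 ≤ w) (h : W1 μ ν ≤ ENNReal.ofReal w)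
    (x : Space d) : ‖velocity vd K μ x - velocity vd K ν x‖ ≤ k * w := by
  have hlip := lipschitzWith_comp_sub hK x
  have hlt : ∀ w' : ℝ, w < w' → ‖velocity vd K μ x - velocity vd K ν x‖ ≤ k * w' := by
    intro w' hw'
    obtain ⟨π, hπ, hi, hle⟩ := exists_plan_integral_le_of_W1_lt
      (h.trans_lt ((ENNReal.ofReal_lt_ofReal_iff (hw.trans_lt hw')).2 hw'))
    have e : velocity vd K μ x - velocity vd K ν x = ∫ p, (K (p.2 - x) - K (p.1 - x)) ∂π := by
      rw [integral_sub
        (integrable_snd_of_mem_transferencePlans hπ hlip.continuous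
          (integrable_of_lipschitzWith hν hlip))
        (integrable_fst_of_mem_transferencePlans hπ hlip.continuous
          (integrable_of_lipschitzWith hμ hlip)),
        integral_fst_of_mem_transferencePlans hπ hlip.continuous,
        integral_snd_of_mem_transferencePlans hπ hlip.continuous]
      simp [velocity]
    rw [e]
    calc ‖∫ p, (K (p.2 - x) - K (p.1 - x)) ∂π‖
        ≤ ∫ p, (k : ℝ) * ‖p.1 - p.2‖ ∂π := by
          refine norm_integral_le_of_norm_le (hi.const_mul _) (ae_of_all _ fun p => ?_)
          rw [norm_sub_rev]
          exact hlip.norm_sub_le p.1 p.2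
      _ = k * ∫ p, ‖p.1 - p.2‖ ∂π := integral_const_mul _ _
      _ ≤ k * w' := by gcongr
  refine ge_of_tendsto (x := 𝓝[>] w) (f := fun w' : ℝ => (k : ℝ) * w') ?_
    (eventually_nhdsWithin_of_forall hlt)
  exact (tendsto_id.const_mul _).mono_left nhdsWithin_le_nhds

lemma lipschitzWith_velocity {N : ℕ} {vd K : Space d → Space d} {Lv k : ℝ≥0}
    (hvd : LipschitzWith Lv vd) (hK : LipschitzWith k K) {μ : Measure (Space d)}
    (hμ : μ ∈ massMeasures d N) : LipschitzWith (Lv + N * k) (velocity vd K μ) := by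
  have := isFiniteMeasure_of_mem_massMeasures hμ
  have hlip := lipschitzWith_comp_sub hK
  have hint : LipschitzWith (N * k) fun x => ∫ y, K (y - x) ∂μ := by
    refine LipschitzWith.of_dist_le_mul fun x x' => ?_
    rw [dist_eq_norm, ← integral_sub (integrable_of_lipschitzWith hμ (hlip x))
      (integrable_of_lipschitzWith hμ (hlip x'))]
    refine (norm_integral_le_of_norm_le_const (C := k * dist x x')
      (ae_of_all _ fun y => ?_)).trans_eq ?_
    · refine (hK.norm_sub_le _ _).trans_eq ?_
      rw [dist_eq_norm, norm_sub_rev x x', sub_sub_sub_cancel_left]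
    · rw [real_univ_of_mem_massMeasures hμ]; push_cast; ring
  exact hvd.sub hint

/-- Up to an error `ε`, a continuous function of compact support is Lipschitz. -/
lemma exists_le_add_mul_of_hasCompactSupport {g : Space d → ℝ} (hg : Continuous g)
    (hs : HasCompactSupport g) {ε : ℝ} (hε : 0 < ε) :
    ∃ C : ℝ, 0 ≤ C ∧ ∀ x y, |g x - g y| ≤ ε + C * ‖x - y‖ := by
  obtain ⟨B, hB⟩ := hs.exists_bound_of_continuous hg
  obtain ⟨δ, hδ, h⟩ := Metric.uniformContinuous_iff.1 (hs.uniformContinuous_of_continuous hg) ε hε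
  have hB0 : 0 ≤ B := (norm_nonneg _).trans (hB 0)
  refine ⟨2 * B / δ, by positivity, fun x y => ?_⟩
  by_cases hxy : ‖x - y‖ < δ
  · have h1 := h (a := x) (b := y) (by rwa [dist_eq_norm])
    rw [Real.dist_eq] at h1
    have : 0 ≤ 2 * B / δ * ‖x - y‖ := by positivity
    linarith
  · have h1 : |g x - g y| ≤ 2 * B := by
      have := norm_sub_le (g x) (g y)
      rw [Real.norm_eq_abs] at this
      linarith [hB x, hB y]
    have h2 : 2 * B ≤ 2 * B / δ * ‖x - y‖ := by
      rw [div_mul_eq_mul_div, le_div_iff₀ hδ]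
      gcongr
      exact not_lt.1 hxy
    linarith

lemma integrable_of_hasCompactSupport {μ : Measure (Space d)} [IsFiniteMeasure μ] {g : Space d → ℝ}
    (hg : Continuous g) (hs : HasCompactSupport g) : Integrable g μ :=
  hg.integrable_of_hasCompactSupport hs

/-- `W1`-convergence implies convergence of the integrals of compactly supported functions. -/
lemma tendsto_integral_of_tendsto_W1 {ι : Type*} {l : Filter ι} {N : ℕ} {μ : ι → Measure (Space d)}
    {ν : Measure (Space d)} (hμ : ∀ᶠ i in l, μ i ∈ massMeasures d N) (hν : ν ∈ massMeasures d N)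
    (h : Tendsto (fun i => W1 (μ i) ν) l (𝓝 0)) {g : Space d → ℝ} (hg : Continuous g)
    (hs : HasCompactSupport g) : Tendsto (fun i => ∫ x, g x ∂(μ i)) l (𝓝 (∫ x, g x ∂ν)) := by
  rw [Metric.tendsto_nhds]
  intro ε hε
  obtain ⟨C, hC, hgC⟩ := exists_le_add_mul_of_hasCompactSupport hg hs
    (ε := ε / (2 * (N + 1))) (by positivity)
  have hw : 0 < ε / (2 * (C + 1)) := by positivity
  filter_upwards [hμ, h.eventually_lt_const (ENNReal.ofReal_pos.2 hw)] with i hi hlt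
  have := isFiniteMeasure_of_mem_massMeasures hi
  have := isFiniteMeasure_of_mem_massMeasures hν
  obtain ⟨π, hπ, hint, hle⟩ := exists_plan_integral_le_of_W1_lt hlt
  have := transferencePlans_isFiniteMeasure hπ
  have hmass : π.real univ = N := by
    rw [← real_univ_of_mem_massMeasures hi, ← hπ.1, map_measureReal_apply measurable_fst .univ,
      preimage_univ]
  rw [Real.dist_eq, ← integral_fst_of_mem_transferencePlans hπ hg,
    ← integral_snd_of_mem_transferencePlans hπ hg,
    ← integral_sub
      (integrable_fst_of_mem_transferencePlans hπ hg (integrable_of_hasCompactSupport hg hs))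
      (integrable_snd_of_mem_transferencePlans hπ hg (integrable_of_hasCompactSupport hg hs)),
    ← Real.norm_eq_abs]
  calc ‖∫ p, (g p.1 - g p.2) ∂π‖
      ≤ ∫ p, (ε / (2 * (N + 1)) + C * ‖p.1 - p.2‖) ∂π :=
        norm_integral_le_of_norm_le ((integrable_const _).add (hint.const_mul _))
          (ae_of_all _ fun p => hgC p.1 p.2)
    _ = N * (ε / (2 * (N + 1))) + C * ∫ p, ‖p.1 - p.2‖ ∂π := by
        rw [integral_add (integrable_const _) (hint.const_mul _), integral_const_mul,
          integral_const, hmass, smul_eq_mul]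
    _ ≤ N * (ε / (2 * (N + 1))) + C * (ε / (2 * (C + 1))) := by gcongr
    _ < ε := by
        have h1 : N * (ε / (2 * (N + 1))) < ε / 2 := by
          rw [mul_div_assoc', div_lt_div_iff₀ (by positivity) (by norm_num)]
          nlinarith
        have h2 : C * (ε / (2 * (C + 1))) < ε / 2 := by
          rw [mul_div_assoc', div_lt_div_iff₀ (by positivity) (by norm_num)]
          nlinarith
        linarith

end Plans

/-! ### Characteristics of a Lipschitz field on a short time interval -/

/-- The field `b` is `L`-Lipschitz in space and continuous in time, uniformly in space, on the time
interval `[s, e]`. -/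
structure IsLipschitzField {E : Type*} [NormedAddCommGroup E] (b : ℝ → E → E) (L : ℝ≥0)
    (s e : ℝ) : Prop where
  lipschitz : ∀ t ∈ Icc s e, LipschitzWith L (b t)
  continuous : ∀ t ∈ Icc s e, ∀ ε > 0, ∀ᶠ r in 𝓝[Icc s e] t, ∀ x, ‖b r x - b t x‖ ≤ ε

/-- A Lipschitz field on a time interval of length at most `1 / (4 L)`. On such a short interval
characteristics are defined for all initial points and displace a point `x` by at most
`const + ‖x‖ / 2`. -/
structure IsShortTimeField {E : Type*} [NormedAddCommGroup E] (b : ℝ → E → E) (L : ℝ≥0)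
    (s e : ℝ) : Prop extends IsLipschitzField b L s e where
  short : L * (e - s) ≤ 1 / 4

lemma gronwallBound_le_mul_exp {δ K ε x : ℝ} (hK : 0 ≤ K) (hε : 0 ≤ ε) :
    gronwallBound δ K ε x ≤ (δ + ε * x) * Real.exp (K * x) := by
  rcases hK.eq_or_lt with rfl | hK
  · simp [gronwallBound_K0]
  · rw [gronwallBound_of_K_ne_0 hK.ne']
    have h : Real.exp (K * x) - 1 ≤ K * x * Real.exp (K * x) := by
      have h1 := Real.add_one_le_exp (-(K * x))
      have h2 : Real.exp (-(K * x)) * Real.exp (K * x) = 1 := by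
        rw [← Real.exp_add]; simp
      nlinarith [Real.exp_pos (K * x)]
    have h2 : ε / K * (Real.exp (K * x) - 1) ≤ ε / K * (K * x * Real.exp (K * x)) := by gcongr
    have h3 : ε / K * (K * x * Real.exp (K * x)) = ε * x * Real.exp (K * x) := by field_simp
    simp only
    linarith

lemma exp_le_two_of_le_quarter {y : ℝ} (hy : y ≤ 1 / 4) : Real.exp y ≤ 2 :=
  (Real.exp_le_exp.2 hy).trans (by
    have h := Real.exp_one_lt_d9
    have h4 : Real.exp (1 / 4) ^ 4 = Real.exp 1 := by rw [← Real.exp_nat_mul]; norm_num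
    by_contra! hlt
    have : (2 : ℝ) ^ 4 < Real.exp (1 / 4) ^ 4 := by gcongr
    linarith)

section Curves

variable {E : Type*} [NormedAddCommGroup E] {b : ℝ → E → E} {L : ℝ≥0} {s e : ℝ}

lemma IsShortTimeField.mono (hb : IsShortTimeField b L s e) {t r : ℝ} (ht : s ≤ t) (hr : r ≤ e) :
    IsShortTimeField b L t r where
  lipschitz q hq := hb.lipschitz q ⟨ht.trans hq.1, hq.2.trans hr⟩
  continuous q hq ε hε := (hb.continuous q ⟨ht.trans hq.1, hq.2.trans hr⟩ ε hε).filter_mono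
    (nhdsWithin_mono _ (Icc_subset_Icc ht hr))
  short := (mul_le_mul_of_nonneg_left (by linarith) L.2).trans hb.short

lemma IsShortTimeField.continuousOn (hb : IsShortTimeField b L s e) (x : E) :
    ContinuousOn (fun t => b t x) (Icc s e) := by
  intro t ht
  rw [ContinuousWithinAt, Metric.tendsto_nhds]
  intro ε hε
  filter_upwards [hb.continuous t ht (ε / 2) (by positivity)] with r hr
  rw [dist_eq_norm]
  linarith [hr x]

lemma IsShortTimeField.exists_bound (hb : IsShortTimeField b L s e) :
    ∃ M : ℝ, 0 ≤ M ∧ ∀ t ∈ Icc s e, ∀ x, ‖b t x‖ ≤ M + L * ‖x‖ := by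
  obtain ⟨M, hM⟩ := isCompact_Icc.exists_bound_of_continuousOn (hb.continuousOn 0)
  refine ⟨max M 0, le_max_right _ _, fun t ht x => ?_⟩
  have h1 := (hb.lipschitz t ht).norm_sub_le x 0
  rw [sub_zero] at h1
  have h2 := norm_le_norm_add_norm_sub' (b t x) (b t 0)
  linarith [hM t ht, le_max_left M 0]

variable [NormedSpace ℝ E]

lemma hasDerivWithinAt_Ici_of_isIntegralCurveOn {γ : ℝ → E} {t r : ℝ}
    (hγ : IsIntegralCurveOn γ b (Icc t e)) (hr : r ∈ Ico t e) :
    HasDerivWithinAt γ (b r (γ r)) (Ici r) r :=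
  ((hγ r ⟨hr.1, hr.2.le⟩).mono (Icc_subset_Icc_left hr.1)).mono_of_mem_nhdsWithin
    (Icc_mem_nhdsGE hr.2)

/-- Stability of characteristics: perturbing the initial point by `δ` and the field by `η` moves
the endpoint by at most `2 (δ + η (e - t))` on a short time interval. -/
lemma IsShortTimeField.norm_sub_le (hb : IsShortTimeField b L s e) {b' : ℝ → E → E} {γ γ' : ℝ → E}
    (hγ : IsIntegralCurveOn γ b (Icc s e)) (hγ' : IsIntegralCurveOn γ' b' (Icc s e)) {η : ℝ}
    (hη : 0 ≤ η) (hbb' : ∀ r ∈ Icc s e, ‖b' r (γ' r) - b r (γ' r)‖ ≤ η) {r : ℝ}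
    (hr : r ∈ Icc s e) : ‖γ r - γ' r‖ ≤ 2 * (‖γ s - γ' s‖ + η * (r - s)) := by
  have h := dist_le_of_approx_trajectories_ODE_of_mem (s := fun _ => univ) (εf := 0) (εg := η)
    (fun q hq => (hb.lipschitz q ⟨hq.1, hq.2.le⟩).lipschitzOnWith)
    hγ.continuousOn (fun q hq =>
      hasDerivWithinAt_Ici_of_isIntegralCurveOn hγ hq) (fun q _ => (dist_self _).le)
    (fun _ _ => mem_univ _)
    hγ'.continuousOn (fun q hq =>
      hasDerivWithinAt_Ici_of_isIntegralCurveOn hγ' hq)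
    (fun q hq => by rw [dist_eq_norm]; exact hbb' q ⟨hq.1, hq.2.le⟩)
    (fun _ _ => mem_univ _) (dist_eq_norm (γ s) (γ' s)).le r hr
  rw [dist_eq_norm, zero_add] at h
  have hrs : 0 ≤ r - s := sub_nonneg.2 hr.1
  have hexp : Real.exp (L * (r - s)) ≤ 2 := exp_le_two_of_le_quarter
    ((mul_le_mul_of_nonneg_left (by linarith [hr.2]) L.2).trans hb.short)
  have h2 := gronwallBound_le_mul_exp (δ := ‖γ s - γ' s‖) (x := r - s) L.2 hη
  have h3 : (‖γ s - γ' s‖ + η * (r - s)) * Real.exp (L * (r - s)) ≤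
      (‖γ s - γ' s‖ + η * (r - s)) * 2 := by gcongr
  exact h.trans (h2.trans (h3.trans_eq (mul_comm _ _)))

lemma IsShortTimeField.norm_sub_le_two_mul (hb : IsShortTimeField b L s e) {γ γ' : ℝ → E}
    (hγ : IsIntegralCurveOn γ b (Icc s e)) (hγ' : IsIntegralCurveOn γ' b (Icc s e)) {r : ℝ}
    (hr : r ∈ Icc s e) : ‖γ r - γ' r‖ ≤ 2 * ‖γ s - γ' s‖ := by
  simpa using hb.norm_sub_le hγ hγ' le_rfl (fun _ _ => by simp) hr

/-- A characteristic is compared with the constant curve at its initial point. -/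
lemma IsShortTimeField.norm_sub_initial_le (hb : IsShortTimeField b L s e) {γ : ℝ → E}
    (hγ : IsIntegralCurveOn γ b (Icc s e)) {M : ℝ} (hM : ∀ t ∈ Icc s e, ∀ x, ‖b t x‖ ≤ M + L * ‖x‖)
    {r : ℝ} (hr : r ∈ Icc s e) : ‖γ r - γ s‖ ≤ 2 * (M + L * ‖γ s‖) * (r - s) := by
  have hη : 0 ≤ M + L * ‖γ s‖ := (norm_nonneg _).trans (hM s ⟨le_rfl, hr.1.trans hr.2⟩ (γ s))
  have h := hb.norm_sub_le (b' := fun _ _ => 0) hγ (γ' := fun _ => γ s)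
    (fun t _ => hasDerivWithinAt_const _ _ _) hη
    (fun q hq => by simpa using hM q hq (γ s)) hr
  simpa [mul_assoc] using h

/-- Characteristics started at time `s` on a short interval exist. -/
lemma IsShortTimeField.exists_isIntegralCurveOn [CompleteSpace E] (hb : IsShortTimeField b L s e)
    (hse : s ≤ e) (x : E) : ∃ γ : ℝ → E, γ s = x ∧ IsIntegralCurveOn γ b (Icc s e) := by
  obtain ⟨M, hM0, hM⟩ := hb.exists_bound
  -- the radius `a` satisfies `(M + L (‖x‖ + a)) (e - s) ≤ a` because `L (e - s) ≤ 1 / 4`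
  let a : ℝ≥0 := ⟨2 * M * (e - s) + ‖x‖, add_nonneg
    (mul_nonneg (by positivity) (sub_nonneg.2 hse)) (norm_nonneg _)⟩
  let B : ℝ≥0 := ⟨M + L * (‖x‖ + a), by positivity⟩
  have hpl : IsPicardLindelof b (tmin := s) (tmax := e) ⟨s, le_rfl, hse⟩ x a 0 B L :=
    { lipschitzOnWith := fun t ht => (hb.lipschitz t ht).lipschitzOnWith
      continuousOn := fun y _ => hb.continuousOn y
      norm_le := fun t ht y hy => by
        refine (hM t ht y).trans ?_
        have h1 : ‖y‖ ≤ ‖x‖ + a := norm_le_of_mem_closedBall hy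
        change M + L * ‖y‖ ≤ M + L * (‖x‖ + a)
        gcongr
      mul_max_le := by
        have h0 : max (e - s) (s - s) = e - s := by
          rw [sub_self]; exact max_eq_left (sub_nonneg.2 hse)
        change (M + L * (‖x‖ + (2 * M * (e - s) + ‖x‖))) * max (e - s) (s - s) ≤
          2 * M * (e - s) + ‖x‖ - 0
        rw [h0]
        have h1 : L * (e - s) * (2 * ‖x‖ + 2 * M * (e - s)) ≤
            1 / 4 * (2 * ‖x‖ + 2 * M * (e - s)) := by
          refine mul_le_mul_of_nonneg_right hb.short ?_
          have := sub_nonneg.2 hse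
          positivity
        have h2 : 0 ≤ M * (e - s) := mul_nonneg hM0 (sub_nonneg.2 hse)
        nlinarith [norm_nonneg x] }
  exact hpl.exists_eq_forall_mem_Icc_hasDerivWithinAt₀

lemma norm_sub_sub_smul_le_of_isIntegralCurveOn {γ : ℝ → E} {t r : ℝ}
    (hγ : IsIntegralCurveOn γ b (Icc t e)) (hr : r ∈ Icc t e) {w : E} {C : ℝ}
    (hC : ∀ q ∈ Icc t r, ‖b q (γ q) - w‖ ≤ C) : ‖γ r - γ t - (r - t) • w‖ ≤ C * (r - t) := by
  have h := norm_image_sub_le_of_norm_deriv_right_le_segment (f := fun q => γ q - (q - t) • w)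
    (f' := fun q => b q (γ q) - w) (a := t) (b := r) (C := C)
    ((hγ.continuousOn.mono (Icc_subset_Icc_right hr.2)).sub (by fun_prop))
    (fun q hq => by
      have h1 : HasDerivWithinAt (fun q : ℝ => (q - t) • w) w (Ici q) q := by
        simpa using (((hasDerivWithinAt_id q (Ici q)).sub_const t).smul_const w)
      exact (hasDerivWithinAt_Ici_of_isIntegralCurveOn hγ ⟨hq.1, hq.2.trans_le hr.2⟩).sub h1)
    (fun q hq => hC q ⟨hq.1, hq.2.le⟩) r ⟨hr.1, le_rfl⟩
  simp only [sub_self, zero_smul, sub_zero] at h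
  rwa [sub_right_comm] at h

end Curves

/-! ### Mollification -/

section Duality

variable {d : ℕ}

/-- The mollification `η * u`, where `η` is the normalization of the bump function `φ`. -/
def mollify (φ : ContDiffBump (0 : Space d)) (u : Space d → ℝ) (x : Space d) : ℝ :=
  ∫ z, φ.normed volume z * u (x - z)

lemma integrable_normed_mul (φ : ContDiffBump (0 : Space d)) {f : Space d → ℝ}
    (hf : Continuous f) : Integrable fun z => φ.normed volume z * f z :=
  (φ.continuous_normed.mul hf).integrable_of_hasCompactSupport φ.hasCompactSupport_normed.mul_right

/-- The mollifier is a probability density supported in the ball of radius `φ.rOut`. -/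
lemma abs_integral_normed_mul_sub_le (φ : ContDiffBump (0 : Space d)) {f g : Space d → ℝ}
    (hf : Continuous f) (hg : Continuous g) {c : ℝ}
    (h : ∀ z, ‖z‖ ≤ φ.rOut → |f z - g z| ≤ c) :
    |(∫ z, φ.normed volume z * f z) - ∫ z, φ.normed volume z * g z| ≤ c := by
  rw [← integral_sub (integrable_normed_mul φ hf) (integrable_normed_mul φ hg), ← Real.norm_eq_abs]
  calc ‖∫ z, (φ.normed volume z * f z - φ.normed volume z * g z)‖
      ≤ ∫ z, φ.normed volume z * c := by
        refine norm_integral_le_of_norm_le (integrable_normed_mul φ continuous_const)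
          (ae_of_all _ fun z => ?_)
        rw [← mul_sub, norm_mul, Real.norm_of_nonneg (φ.nonneg_normed z), Real.norm_eq_abs]
        by_cases hz : ‖z‖ ≤ φ.rOut
        · exact mul_le_mul_of_nonneg_left (h z hz) (φ.nonneg_normed z)
        · have : φ.normed volume z = 0 := by
            rw [← Function.notMem_support, φ.support_normed_eq]
            simp only [Metric.mem_ball, dist_zero_right]
            exact fun h' => hz h'.le
          simp [this]
    _ = c := by rw [integral_mul_const, φ.integral_normed, one_mul]

lemma abs_mollify_sub_le (φ : ContDiffBump (0 : Space d)) {u : Space d → ℝ} {C : ℝ≥0}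
    (hu : LipschitzWith C u) (x : Space d) : |mollify φ u x - u x| ≤ C * φ.rOut := by
  have h := abs_integral_normed_mul_sub_le φ (f := fun z => u (x - z)) (g := fun _ => u x)
    (by have := hu.continuous; fun_prop) continuous_const (c := C * φ.rOut) (fun z hz => by
      have h1 := hu.norm_sub_le (x - z) x
      rw [Real.norm_eq_abs, sub_sub_cancel_left, norm_neg] at h1
      exact h1.trans (by gcongr))
  rwa [integral_mul_const, φ.integral_normed, one_mul] at h

lemma contDiff_mollify (φ : ContDiffBump (0 : Space d)) {u : Space d → ℝ} (hu : Continuous u) :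
    ContDiff ℝ ∞ (mollify φ u) :=
  φ.hasCompactSupport_normed.contDiff_convolution_left (ContinuousLinearMap.lsmul ℝ ℝ)
    φ.contDiff_normed (hu.locallyIntegrable (μ := volume))

lemma mollify_eq_zero (φ : ContDiffBump (0 : Space d)) {u : Space d → ℝ} (hu : Continuous u)
    {R : ℝ} (hR : ∀ x, R < ‖x‖ → u x = 0) {x : Space d} (hx : R + φ.rOut < ‖x‖) :
    mollify φ u x = 0 := by
  have h := abs_integral_normed_mul_sub_le φ (f := fun z => u (x - z)) (g := fun _ => 0)
    (by fun_prop) continuous_const (c := 0) (fun z hz => by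
      have := norm_sub_norm_le x z
      rw [hR (x - z) (by linarith)]
      simp)
  simpa [mollify] using h

lemma hasCompactSupport_of_forall_norm {f : Space d → ℝ} {R : ℝ}
    (h : ∀ x, R < ‖x‖ → f x = 0) : HasCompactSupport f :=
  HasCompactSupport.intro (isCompact_closedBall (0 : Space d) R) fun x hx => h x (by simpa using hx)

lemma fderiv_eq_zero_of_forall_norm {f : Space d → ℝ} {R : ℝ}
    (h : ∀ x, R < ‖x‖ → f x = 0) {x : Space d} (hx : R < ‖x‖) : fderiv ℝ f x = 0 := by
  have : f =ᶠ[𝓝 x] fun _ => 0 := by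
    filter_upwards [(isOpen_lt continuous_const continuous_norm).mem_nhds hx] with y hy
    exact h y hy
  rw [this.fderiv_eq]
  simp

/-- First-order Taylor expansion along vectors of bounded length, uniformly in the base point. -/
lemma eventually_abs_taylor_le {G : Space d → ℝ} (hG : ContDiff ℝ ∞ G) (hs : HasCompactSupport G)
    {R ε : ℝ} (hR : 0 < R) (hε : 0 < ε) : ∀ᶠ h : ℝ in 𝓝[>] 0, ∀ x v : Space d, ‖v‖ ≤ R →
      |G (x - h • v) - G x + h * fderiv ℝ G x v| ≤ ε * h := by
  obtain ⟨δ, hδ, hu⟩ := Metric.uniformContinuous_iff.1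
    ((hs.fderiv ℝ).uniformContinuous_of_continuous (hG.continuous_fderiv (by simp))) (ε / R)
    (by positivity)
  filter_upwards [self_mem_nhdsWithin, mem_nhdsWithin_of_mem_nhds
    (Iio_mem_nhds (show 0 < δ / R by positivity))] with h h0 hlt x v hv
  rw [mem_Ioi] at h0
  rw [mem_Iio, lt_div_iff₀ hR] at hlt
  have hhv : ‖h • v‖ ≤ h * R := by
    rw [norm_smul, Real.norm_of_nonneg h0.le]; gcongr
  have key := (convex_ball x δ).norm_image_sub_le_of_norm_hasFDerivWithin_le' (f := G)
    (f' := fderiv ℝ G) (φ := fderiv ℝ G x) (C := ε / R) (x := x) (y := x - h • v)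
    (fun y _ => (hG.differentiable (by simp) y).hasFDerivAt.hasFDerivWithinAt)
    (fun y hy => by
      rw [← dist_eq_norm]; exact (hu hy).le)
    (Metric.mem_ball_self hδ)
    (by rw [Metric.mem_ball, dist_eq_norm, sub_sub_cancel_left, norm_neg]; linarith)
  rw [sub_sub_cancel_left, map_neg, map_smul, smul_eq_mul, sub_neg_eq_add, norm_neg,
    Real.norm_eq_abs] at key
  refine key.trans ?_
  calc ε / R * ‖h • v‖ ≤ ε / R * (h * R) := by gcongr
    _ = ε * h := by field_simp

/-! ### Weak solutions tested against Lipschitz solutions of the transport equation -/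

/-- A curve of measures of mass at most `m` that is continuous against compactly supported
functions on `[s, e]`. -/
structure IsContinuousCurve (μ : ℝ → Measure (Space d)) (m s e : ℝ) : Prop where
  finite : ∀ t ∈ Icc s e, IsFiniteMeasure (μ t)
  mass_le : ∀ t ∈ Icc s e, (μ t).real univ ≤ m
  continuousOn : ∀ g : Space d → ℝ, Continuous g → HasCompactSupport g →
    ContinuousOn (fun t => ∫ x, g x ∂(μ t)) (Icc s e)

/-- A continuous curve of measures that solves `∂ₜ μ + div (μ b) = 0` weakly on `[s, e]`. -/
structure IsWeakSolutionOn (μ : ℝ → Measure (Space d)) (b : ℝ → Space d → Space d) (m s e : ℝ) :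
    Prop extends IsContinuousCurve μ m s e where
  weak : ∀ φ : Space d → ℝ, ContDiff ℝ ∞ φ → HasCompactSupport φ → ∀ t ∈ Icc s e, ∀ r ∈ Icc s e,
    ∫ x, φ x ∂(μ r) - ∫ x, φ x ∂(μ t) = ∫ q in t..r, ∫ x, fderiv ℝ φ x (b q x) ∂(μ q)

/-- A family of Lipschitz functions, supported in a common ball, that solves the transport equation
`∂ₜ u + b · ∇u = 0`. Since `u` need not be differentiable, the equation is expressed by first-order
differences: moving by `w` instead of `b t y` costs at most `C ‖b t y - w‖` per unit of time. -/
structure IsLipschitzTransport (u : ℝ → Space d → ℝ) (b : ℝ → Space d → Space d) (C : ℝ≥0)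
    (s e : ℝ) : Prop where
  lipschitz : ∀ t ∈ Icc s e, LipschitzWith C (u t)
  support : ∃ R, 0 ≤ R ∧ ∀ t ∈ Icc s e, ∀ x, R < ‖x‖ → u t x = 0
  time_lipschitz : ∃ A, 0 ≤ A ∧ ∀ t ∈ Icc s e, ∀ r ∈ Icc s e, ∀ x, |u r x - u t x| ≤ A * |r - t|
  transport : ∀ t ∈ Ico s e, ∀ R > 0, ∀ ε > 0, ∀ᶠ r in 𝓝[>] t, ∀ y w : Space d,
    ‖y‖ ≤ R → ‖w‖ ≤ R → |u r y - u t (y - (r - t) • w)| ≤ (C * ‖b t y - w‖ + ε) * (r - t)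

variable {μ : ℝ → Measure (Space d)} {b : ℝ → Space d → Space d} {m s e : ℝ} {L C : ℝ≥0}

lemma hasCompactSupport_fderiv_apply {φ : Space d → ℝ} (hs : HasCompactSupport φ)
    (v : Space d → Space d) : HasCompactSupport fun x => fderiv ℝ φ x (v x) :=
  (hs.fderiv ℝ).mono fun x hx h => hx (by simp [h])

lemma abs_integral_le_mul {ν : Measure (Space d)} (hν : ν.real univ ≤ m)
    [IsFiniteMeasure ν] {g : Space d → ℝ} {c : ℝ} (hc : 0 ≤ c) (h : ∀ x, |g x| ≤ c) :
    |∫ x, g x ∂ν| ≤ c * m := by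
  have h1 := norm_integral_le_of_norm_le_const (μ := ν) (f := g) (C := c) (ae_of_all _ h)
  exact h1.trans (by gcongr)

lemma IsContinuousCurve.mass_nonneg (hμ : IsContinuousCurve μ m s e) (hse : s ≤ e) : 0 ≤ m :=
  measureReal_nonneg.trans (hμ.mass_le s ⟨le_rfl, hse⟩)

lemma continuous_fderiv_apply {φ : Space d → ℝ} (hφ : ContDiff ℝ ∞ φ) {v : Space d → Space d}
    (hv : Continuous v) : Continuous fun x => fderiv ℝ φ x (v x) :=
  (hφ.continuous_fderiv (by simp)).clm_apply hv

lemma IsContinuousCurve.continuousOn_flux (hμ : IsContinuousCurve μ m s e)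
    (hb : IsLipschitzField b L s e) {φ : Space d → ℝ} (hφ : ContDiff ℝ ∞ φ)
    (hs : HasCompactSupport φ) :
    ContinuousOn (fun q => ∫ x, fderiv ℝ φ x (b q x) ∂(μ q)) (Icc s e) := by
  intro t ht
  have hm := hμ.mass_nonneg (ht.1.trans ht.2)
  obtain ⟨B, hB⟩ := (hs.fderiv ℝ).exists_bound_of_continuous (hφ.continuous_fderiv (by simp))
  have hB0 : 0 ≤ B := (norm_nonneg _).trans (hB 0)
  have hcont := fun q (hq : q ∈ Icc s e) =>
    continuous_fderiv_apply hφ (hb.lipschitz q hq).continuous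
  have hlim := hμ.continuousOn _ (hcont t ht) (hasCompactSupport_fderiv_apply hs (b t)) t ht
  rw [ContinuousWithinAt, Metric.tendsto_nhds] at hlim ⊢
  intro ε hε
  have hη : 0 < ε / (2 * (B * m + 1)) := by positivity
  filter_upwards [hlim (ε / 2) (by positivity), hb.continuous t ht _ hη, self_mem_nhdsWithin]
    with q hq hbq hqI
  have := hμ.finite q hqI
  rw [Real.dist_eq] at hq ⊢
  have h1 : |(∫ x, fderiv ℝ φ x (b q x) ∂(μ q)) - ∫ x, fderiv ℝ φ x (b t x) ∂(μ q)| ≤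
      B * (ε / (2 * (B * m + 1))) * m := by
    rw [← integral_sub
      (integrable_of_hasCompactSupport (hcont q hqI) (hasCompactSupport_fderiv_apply hs _))
      (integrable_of_hasCompactSupport (hcont t ht) (hasCompactSupport_fderiv_apply hs _))]
    refine abs_integral_le_mul (hμ.mass_le q hqI) (by positivity) fun x => ?_
    rw [← map_sub]
    exact ((fderiv ℝ φ x).le_opNorm _).trans
      (mul_le_mul (hB x) (hbq x) (norm_nonneg _) hB0)
  have h2 : B * (ε / (2 * (B * m + 1))) * m < ε / 2 := by
    rw [mul_div_assoc', div_mul_eq_mul_div, div_lt_div_iff₀ (by positivity) (by norm_num)]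
    nlinarith
  have h3 := abs_sub_le (∫ x, fderiv ℝ φ x (b q x) ∂(μ q)) (∫ x, fderiv ℝ φ x (b t x) ∂(μ q))
    (∫ x, fderiv ℝ φ x (b t x) ∂(μ t))
  linarith

lemma IsWeakSolutionOn.eventually_abs_increment_sub_le (hμ : IsWeakSolutionOn μ b m s e)
    (hb : IsLipschitzField b L s e) {φ : Space d → ℝ} (hφ : ContDiff ℝ ∞ φ)
    (hs : HasCompactSupport φ) {t : ℝ} (ht : t ∈ Ico s e) {ε : ℝ} (hε : 0 < ε) :
    ∀ᶠ r in 𝓝[>] t, |∫ x, φ x ∂(μ r) - ∫ x, φ x ∂(μ t) -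
      (r - t) * ∫ x, fderiv ℝ φ x (b t x) ∂(μ t)| ≤ ε * (r - t) := by
  have hF := hμ.continuousOn_flux hb hφ hs
  set F := fun q => ∫ x, fderiv ℝ φ x (b q x) ∂(μ q) with hFdef
  have htI : t ∈ Icc s e := ⟨ht.1, ht.2.le⟩
  obtain ⟨δ, hδ, hd⟩ := Metric.continuousWithinAt_iff.1 (hF t htI) ε hε
  filter_upwards [Ioo_mem_nhdsGT (show t < min e (t + δ) from lt_min ht.2 (by linarith))]
    with r hr
  have hre : r ≤ e := hr.2.le.trans (min_le_left _ _)
  have hrδ : r < t + δ := hr.2.trans_le (min_le_right _ _)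
  have hrI : r ∈ Icc s e := ⟨ht.1.trans hr.1.le, hre⟩
  rw [hμ.weak φ hφ hs t htI r hrI]
  have hint : IntervalIntegrable F volume t r :=
    (hF.mono (by rw [uIcc_of_le hr.1.le]; exact Icc_subset_Icc ht.1 hre)).intervalIntegrable
  have e1 : (∫ q in t..r, F q) - (r - t) * F t = ∫ q in t..r, (F q - F t) := by
    rw [intervalIntegral.integral_sub hint intervalIntegrable_const,
      intervalIntegral.integral_const, smul_eq_mul]
  change |(∫ q in t..r, F q) - (r - t) * F t| ≤ _
  rw [e1, ← Real.norm_eq_abs, ← abs_of_pos (sub_pos.2 hr.1)]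
  refine intervalIntegral.norm_integral_le_of_norm_le_const fun q hq => ?_
  rw [uIoc_of_le hr.1.le] at hq
  rw [← dist_eq_norm]
  refine (hd ⟨ht.1.trans hq.1.le, hq.2.trans hre⟩ ?_).le
  rw [Real.dist_eq, abs_of_pos (sub_pos.2 hq.1)]
  linarith [hq.2]

variable {u : ℝ → Space d → ℝ}

/-- Commutator estimate: the mollification of a Lipschitz solution of the transport equation solves
it up to an error `C L δ`, where `δ` is the radius of the mollifier, because the field varies by at
most `L δ` over the support of the mollifier. -/
lemma IsLipschitzTransport.eventually_abs_mollify_sub_le (hu : IsLipschitzTransport u b C s e)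
    (hb : IsShortTimeField b L s e) (φ : ContDiffBump (0 : Space d)) {t : ℝ} (ht : t ∈ Ico s e)
    {ε : ℝ} (hε : 0 < ε) : ∀ᶠ r in 𝓝[>] t, ∀ x,
      |mollify φ (u r) x - mollify φ (u t) x + (r - t) * fderiv ℝ (mollify φ (u t)) x (b t x)| ≤
        (C * (L * φ.rOut) + ε) * (r - t) := by
  obtain ⟨R, hR0, hR⟩ := hu.support
  obtain ⟨M, hM0, hM⟩ := hb.exists_bound
  have htI : t ∈ Icc s e := ⟨ht.1, ht.2.le⟩
  have hδ := φ.rOut_pos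
  have hut := (hu.lipschitz t htI).continuous
  have hR₁ : 0 ≤ R + φ.rOut := by positivity
  have hzero : ∀ r ∈ Icc s e, ∀ x, R + φ.rOut < ‖x‖ → mollify φ (u r) x = 0 := fun r hr x hx =>
    mollify_eq_zero φ (hu.lipschitz r hr).continuous (hR r hr) hx
  have hw₀ : 0 < M + L * (R + φ.rOut) + 1 := by positivity
  have htaylor := eventually_abs_taylor_le (contDiff_mollify φ hut)
    (hasCompactSupport_of_forall_norm (hzero t htI)) hw₀ (half_pos hε)
  have hshift : Tendsto (fun r => r - t) (𝓝[>] t) (𝓝[>] 0) := by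
    refine tendsto_nhdsWithin_iff.2 ⟨?_, ?_⟩
    · have : Tendsto (fun r => r - t) (𝓝 t) (𝓝 (t - t)) := tendsto_id.sub_const t
      rw [sub_self] at this
      exact this.mono_left nhdsWithin_le_nhds
    · filter_upwards [self_mem_nhdsWithin] with r hr
      exact mem_Ioi.2 (sub_pos.2 (mem_Ioi.1 hr))
  filter_upwards [hshift.eventually htaylor, Ioo_mem_nhdsGT ht.2,
    hu.transport t ht (R + φ.rOut + φ.rOut + (M + L * (R + φ.rOut) + 1)) (by positivity) (ε / 2)
      (half_pos hε)] with r htay hr htr x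
  have hrI : r ∈ Icc s e := ⟨ht.1.trans hr.1.le, hr.2.le⟩
  have hrt : 0 < r - t := sub_pos.2 hr.1
  -- for large `x` all terms vanish; otherwise `u r` is compared with the shift of `u t` by
  -- `(r - t) • b t x` under the mollifier, and the shift is expanded to first order
  by_cases hx : ‖x‖ ≤ R + φ.rOut
  · have hw : ‖b t x‖ ≤ M + L * (R + φ.rOut) + 1 := by
      have h1 := hM t htI x
      have h2 : L * ‖x‖ ≤ L * (R + φ.rOut) := by gcongr
      linarith
    have h1 : |mollify φ (u r) x - mollify φ (u t) (x - (r - t) • b t x)| ≤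
        (C * (L * φ.rOut) + ε / 2) * (r - t) := by
      have hur := (hu.lipschitz r hrI).continuous
      refine abs_integral_normed_mul_sub_le φ (f := fun z => u r (x - z))
        (g := fun z => u t (x - (r - t) • b t x - z)) (by fun_prop) (by fun_prop) fun z hz => ?_
      have h2 := htr (x - z) (b t x)
        ((norm_sub_le x z).trans (by linarith)) (hw.trans (by linarith))
      rw [sub_right_comm x z] at h2
      refine h2.trans ?_
      gcongr
      have h3 := (hb.lipschitz t htI).norm_sub_le (x - z) x
      rw [sub_sub_cancel_left, norm_neg] at h3
      exact h3.trans (by gcongr)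
    have h2 := htay x (b t x) hw
    have h3 := abs_add_le (mollify φ (u r) x - mollify φ (u t) (x - (r - t) • b t x))
      (mollify φ (u t) (x - (r - t) • b t x) - mollify φ (u t) x +
        (r - t) * fderiv ℝ (mollify φ (u t)) x (b t x))
    rw [← add_assoc, sub_add_sub_cancel] at h3
    refine h3.trans ((add_le_add h1 h2).trans_eq ?_)
    ring
  · rw [not_le] at hx
    rw [hzero r hrI x hx, hzero t htI x hx, fderiv_eq_zero_of_forall_norm (hzero t htI) hx]
    simp only [sub_self, zero_apply, mul_zero, add_zero, abs_zero]
    positivity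

/-- The integral of the mollified test function along the weak solution has right derivative of
size at most `m C L δ`. -/
lemma IsWeakSolutionOn.eventually_abs_pairing_sub_le (hμ : IsWeakSolutionOn μ b m s e)
    (hu : IsLipschitzTransport u b C s e) (hb : IsShortTimeField b L s e)
    (φ : ContDiffBump (0 : Space d)) {t : ℝ} (ht : t ∈ Ico s e) {ε : ℝ} (hε : 0 < ε) :
    ∀ᶠ r in 𝓝[>] t, |∫ x, mollify φ (u r) x ∂(μ r) - ∫ x, mollify φ (u t) x ∂(μ t)| ≤
      (C * (L * φ.rOut) * m + ε) * (r - t) := by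
  obtain ⟨R, hR0, hR⟩ := hu.support
  have htI : t ∈ Icc s e := ⟨ht.1, ht.2.le⟩
  have hm := hμ.mass_nonneg (ht.1.trans ht.2.le)
  have hcs : ∀ r ∈ Icc s e, HasCompactSupport (mollify φ (u r)) := fun r hr =>
    hasCompactSupport_of_forall_norm fun x hx =>
      mollify_eq_zero φ (hu.lipschitz r hr).continuous (hR r hr) hx
  have hcd : ∀ r ∈ Icc s e, ContDiff ℝ ∞ (mollify φ (u r)) := fun r hr =>
    contDiff_mollify φ (hu.lipschitz r hr).continuous
  -- the transport term `D` of the test function and the flux of the weak equation cancel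
  set D : Space d → ℝ := fun x => fderiv ℝ (mollify φ (u t)) x (b t x) with hD
  have hDc : Continuous D := continuous_fderiv_apply (hcd t htI) (hb.lipschitz t htI).continuous
  have hDs : HasCompactSupport D := hasCompactSupport_fderiv_apply (hcs t htI) _
  have hε' : 0 < ε / (m + 2) := by positivity
  have hDlim : ∀ᶠ r in 𝓝[>] t, |∫ x, D x ∂(μ r) - ∫ x, D x ∂(μ t)| < ε / (m + 2) := by
    have h1 := hμ.continuousOn D hDc hDs t htI
    rw [ContinuousWithinAt, Metric.tendsto_nhds] at h1
    exact (h1 _ hε').filter_mono (nhdsWithin_le_of_mem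
      (mem_of_superset (Ioo_mem_nhdsGT ht.2) ((Ioo_subset_Ioo_left ht.1).trans Ioo_subset_Icc_self)))
  filter_upwards [hDlim, Ioo_mem_nhdsGT ht.2, hu.eventually_abs_mollify_sub_le hb φ ht hε',
    hμ.eventually_abs_increment_sub_le hb.toIsLipschitzField (hcd t htI) (hcs t htI) ht hε']
    with r h1 hr h2 h3
  have hrI : r ∈ Icc s e := ⟨ht.1.trans hr.1.le, hr.2.le⟩
  have hrt : 0 < r - t := sub_pos.2 hr.1
  have := hμ.finite r hrI
  have hir := integrable_of_hasCompactSupport (μ := μ r) (hcd r hrI).continuous (hcs r hrI)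
  have hit := integrable_of_hasCompactSupport (μ := μ r) (hcd t htI).continuous (hcs t htI)
  have hiD := integrable_of_hasCompactSupport (μ := μ r) hDc hDs
  have h4 : |∫ x, mollify φ (u r) x ∂(μ r) - ∫ x, mollify φ (u t) x ∂(μ r) +
      (r - t) * ∫ x, D x ∂(μ r)| ≤ (C * (L * φ.rOut) + ε / (m + 2)) * (r - t) * m := by
    rw [← integral_const_mul, ← integral_sub hir hit]
    have hadd := integral_add (hir.sub hit) (hiD.const_mul (r - t))
    simp only [Pi.sub_apply] at hadd
    rw [← hadd]
    have := φ.rOut_pos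
    exact abs_integral_le_mul (hμ.mass_le r hrI) (by positivity) h2
  have h5 : |(r - t) * (∫ x, D x ∂(μ r) - ∫ x, D x ∂(μ t))| ≤ (r - t) * (ε / (m + 2)) := by
    rw [abs_mul, abs_of_pos hrt]
    gcongr
  have h6 : ε / (m + 2) * (r - t) * m + ε / (m + 2) * (r - t) + (r - t) * (ε / (m + 2)) =
      ε * (r - t) := by
    field_simp; ring
  rw [abs_le] at h3 h4 h5 ⊢
  constructor <;> linarith [h3.1, h3.2, h4.1, h4.2, h5.1, h5.2]

lemma IsWeakSolutionOn.continuousOn_pairing (hμ : IsWeakSolutionOn μ b m s e)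
    (hu : IsLipschitzTransport u b C s e) (φ : ContDiffBump (0 : Space d)) :
    ContinuousOn (fun t => ∫ x, mollify φ (u t) x ∂(μ t)) (Icc s e) := by
  intro t ht
  obtain ⟨R, hR0, hR⟩ := hu.support
  obtain ⟨A, hA0, hA⟩ := hu.time_lipschitz
  have hm := hμ.mass_nonneg (ht.1.trans ht.2)
  have hc : ∀ r ∈ Icc s e, Continuous (mollify φ (u r)) := fun r hr =>
    (contDiff_mollify φ (hu.lipschitz r hr).continuous).continuous
  have hcs : ∀ r ∈ Icc s e, HasCompactSupport (mollify φ (u r)) := fun r hr =>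
    hasCompactSupport_of_forall_norm fun x hx =>
      mollify_eq_zero φ (hu.lipschitz r hr).continuous (hR r hr) hx
  have hlim := hμ.continuousOn _ (hc t ht) (hcs t ht) t ht
  rw [ContinuousWithinAt, Metric.tendsto_nhds] at hlim ⊢
  intro ε hε
  have hη : 0 < ε / (2 * (A * m + 1)) := by positivity
  filter_upwards [hlim (ε / 2) (by positivity), self_mem_nhdsWithin,
    mem_nhdsWithin_of_mem_nhds (Metric.ball_mem_nhds t hη)] with r hr hrI hrt
  have := hμ.finite r hrI
  rw [Metric.mem_ball, Real.dist_eq] at hrt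
  rw [Real.dist_eq] at hr ⊢
  have h1 : |∫ x, mollify φ (u r) x ∂(μ r) - ∫ x, mollify φ (u t) x ∂(μ r)| ≤
      A * |r - t| * m := by
    rw [← integral_sub (integrable_of_hasCompactSupport (hc r hrI) (hcs r hrI))
      (integrable_of_hasCompactSupport (hc t ht) (hcs t ht))]
    refine abs_integral_le_mul (hμ.mass_le r hrI) (by positivity) fun x => ?_
    have h2 := (hu.lipschitz r hrI).continuous
    have h3 := (hu.lipschitz t ht).continuous
    exact abs_integral_normed_mul_sub_le φ (by fun_prop) (by fun_prop)
      fun z _ => hA t ht r hrI (x - z)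
  have h2 : A * |r - t| * m ≤ A * (ε / (2 * (A * m + 1))) * m := by gcongr
  have h3 : A * (ε / (2 * (A * m + 1))) * m < ε / 2 := by
    rw [mul_div_assoc', div_mul_eq_mul_div, div_lt_div_iff₀ (by positivity) (by norm_num)]
    nlinarith
  have h4 := abs_sub_le (∫ x, mollify φ (u r) x ∂(μ r)) (∫ x, mollify φ (u t) x ∂(μ r))
    (∫ x, mollify φ (u t) x ∂(μ t))
  linarith

/-- A continuous function whose right difference quotients have upper limit at most `K` in absolute
value changes by at most `K (e - s)` over `[s, e]`. -/
lemma abs_sub_le_mul_of_eventually_abs_sub_le {f : ℝ → ℝ} {K : ℝ} (hse : s ≤ e)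
    (hf : ContinuousOn f (Icc s e))
    (h : ∀ t ∈ Ico s e, ∀ ε > 0, ∀ᶠ r in 𝓝[>] t, |f r - f t| ≤ (K + ε) * (r - t)) :
    |f e - f s| ≤ K * (e - s) := by
  refine image_le_of_liminf_slope_right_le_deriv_boundary (f := fun t => |f t - f s|)
    (B := fun t => K * (t - s)) (B' := fun _ => K) (a := s) (b := e)
    (hf.sub continuousOn_const).abs (by simp) (by fun_prop) (fun t _ => ?_) (fun t ht c hc => ?_)
    ⟨hse, le_rfl⟩
  · simpa using (((hasDerivWithinAt_id t (Ici t)).sub_const s).const_mul K)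
  · refine Eventually.frequently ?_
    filter_upwards [h t ht ((c - K) / 2) (by linarith), self_mem_nhdsWithin] with r hr hrt
    rw [mem_Ioi] at hrt
    have hrt' := sub_pos.2 hrt
    rw [slope_def_field, div_lt_iff₀ hrt']
    have h1 := abs_sub_abs_le_abs_sub (f r - f s) (f t - f s)
    rw [sub_sub_sub_cancel_right] at h1
    nlinarith

/-- Duality: Lipschitz solutions of the transport equation are preserved by weak solutions of the
continuity equation with the same Lipschitz field. -/
theorem IsWeakSolutionOn.integral_eq (hμ : IsWeakSolutionOn μ b m s e)
    (hu : IsLipschitzTransport u b C s e) (hb : IsShortTimeField b L s e) (hse : s ≤ e) :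
    ∫ x, u e x ∂(μ e) = ∫ x, u s x ∂(μ s) := by
  have hm := hμ.mass_nonneg hse
  obtain ⟨R, hR0, hR⟩ := hu.support
  have happrox : ∀ t ∈ Icc s e, ∀ φ : ContDiffBump (0 : Space d),
      |∫ x, mollify φ (u t) x ∂(μ t) - ∫ x, u t x ∂(μ t)| ≤ C * φ.rOut * m := by
    intro t ht φ
    have := hμ.finite t ht
    have hut := (hu.lipschitz t ht).continuous
    rw [← integral_sub
      (integrable_of_hasCompactSupport (contDiff_mollify φ hut).continuous
        (hasCompactSupport_of_forall_norm fun x hx => mollify_eq_zero φ hut (hR t ht) hx))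
      (integrable_of_hasCompactSupport hut (hasCompactSupport_of_forall_norm (hR t ht)))]
    have := φ.rOut_pos
    exact abs_integral_le_mul (hμ.mass_le t ht) (by positivity)
      fun x => abs_mollify_sub_le φ (hu.lipschitz t ht) x
  have hmain : ∀ δ : ℝ, 0 < δ → |∫ x, u e x ∂(μ e) - ∫ x, u s x ∂(μ s)| ≤
      (2 * C * m + C * L * m * (e - s)) * δ := by
    intro δ hδ
    let φ : ContDiffBump (0 : Space d) := ⟨δ / 2, δ, by positivity, by linarith⟩
    have h1 := abs_sub_le_mul_of_eventually_abs_sub_le hse (hμ.continuousOn_pairing hu φ)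
      fun t ht ε hε => hμ.eventually_abs_pairing_sub_le hu hb φ ht hε
    have h2 := happrox e ⟨hse, le_rfl⟩ φ
    have h3 := happrox s ⟨le_rfl, hse⟩ φ
    change _ ≤ C * (L * δ) * m * (e - s) at h1
    change _ ≤ C * δ * m at h2
    change _ ≤ C * δ * m at h3
    rw [abs_le] at h1 h2 h3 ⊢
    constructor <;> linarith [h1.1, h1.2, h2.1, h2.2, h3.1, h3.2]
  refine eq_of_abs_sub_nonpos (ge_of_tendsto (x := 𝓝[>] (0 : ℝ))
    (f := fun δ : ℝ => (2 * C * m + C * L * m * (e - s)) * δ) ?_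
    (eventually_nhdsWithin_of_forall hmain))
  have : Tendsto (fun δ : ℝ => (2 * C * m + C * L * m * (e - s)) * δ) (𝓝 0)
      (𝓝 ((2 * C * m + C * L * m * (e - s)) * 0)) := tendsto_id.const_mul _
  rw [mul_zero] at this
  exact this.mono_left nhdsWithin_le_nhds

end Duality

/-! ### Weak solutions are transported by characteristics -/

section Representation

variable {d : ℕ}

variable {μ : ℝ → Measure (Space d)} {b : ℝ → Space d → Space d} {m s e : ℝ} {L C : ℝ≥0}

/-- Composing a Lipschitz function of bounded support with the characteristic map from time `t` to
the final time `e` gives a Lipschitz solution of the transport equation. -/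
lemma isLipschitzTransport_comp (hb : IsShortTimeField b L s e)
    {Φ : ℝ → Space d → ℝ → Space d} (hΦ₀ : ∀ t ∈ Icc s e, ∀ x, Φ t x t = x)
    (hΦ : ∀ t ∈ Icc s e, ∀ x, IsIntegralCurveOn (Φ t x) b (Icc t e)) {g : Space d → ℝ}
    (hg : LipschitzWith C g) {R : ℝ} (hR : ∀ x, R < ‖x‖ → g x = 0) :
    IsLipschitzTransport (fun t x => g (Φ t x e)) b (2 * C) s e := by
  obtain ⟨M, hM0, hM⟩ := hb.exists_bound
  have hlip : ∀ t ∈ Icc s e, LipschitzWith (2 * C) fun x => g (Φ t x e) := by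
    intro t ht
    refine LipschitzWith.of_dist_le_mul fun x y => ?_
    rw [dist_eq_norm, dist_eq_norm]
    have h1 := hg.norm_sub_le (Φ t x e) (Φ t y e)
    have h2 := (hb.mono ht.1 le_rfl).norm_sub_le_two_mul (hΦ t ht x) (hΦ t ht y)
      (r := e) ⟨ht.2, le_rfl⟩
    rw [hΦ₀ t ht, hΦ₀ t ht] at h2
    have h3 : C * ‖Φ t x e - Φ t y e‖ ≤ C * (2 * ‖x - y‖) := by gcongr
    push_cast
    linarith
  have hflow : ∀ t ∈ Icc s e, ∀ r ∈ Icc t e, ∀ x, g (Φ t x e) = g (Φ r (Φ t x r) e) := by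
    intro t ht r hr x
    have hrI : r ∈ Icc s e := ⟨ht.1.trans hr.1, hr.2⟩
    have h1 : IsIntegralCurveOn (Φ t x) b (Icc r e) := fun q hq =>
      (hΦ t ht x q ⟨hr.1.trans hq.1, hq.2⟩).mono (Icc_subset_Icc_left hr.1)
    have h2 := (hb.mono hrI.1 le_rfl).norm_sub_le_two_mul h1 (hΦ r hrI (Φ t x r)) (r := e)
      ⟨hr.2, le_rfl⟩
    rw [hΦ₀ r hrI, sub_self, norm_zero, mul_zero] at h2
    rw [← eq_of_sub_eq_zero (norm_le_zero_iff.1 h2)]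
  have hdisp : ∀ t ∈ Icc s e, ∀ r ∈ Icc t e, ∀ x,
      ‖Φ t x r - x‖ ≤ 2 * (M + L * ‖x‖) * (r - t) := by
    intro t ht r hr x
    have h1 := (hb.mono ht.1 le_rfl).norm_sub_initial_le (hΦ t ht x)
      (fun q hq => hM q ⟨ht.1.trans hq.1, hq.2⟩) hr
    rwa [hΦ₀ t ht] at h1
  -- a characteristic displaces `x` by at most `2 M (e - s) + ‖x‖ / 2`
  have hsupp : ∀ t ∈ Icc s e, ∀ x, 2 * (|R| + 2 * M * (e - s)) < ‖x‖ → g (Φ t x e) = 0 := by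
    intro t ht x hx
    refine hR _ ?_
    have h1 := hdisp t ht e ⟨ht.2, le_rfl⟩ x
    have h2 : L * (e - t) ≤ 1 / 4 := (hb.mono ht.1 le_rfl).short
    have h3 : L * (e - t) * ‖x‖ ≤ 1 / 4 * ‖x‖ := by gcongr
    have h4 : M * (e - t) ≤ M * (e - s) := by gcongr; exact ht.1
    have h5 := norm_sub_norm_le x (Φ t x e)
    rw [norm_sub_rev] at h5
    linarith [le_abs_self R]
  refine ⟨hlip, ?_, ?_, ?_⟩
  · by_cases hse : s ≤ e
    · have := sub_nonneg.2 hse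
      exact ⟨_, by positivity, hsupp⟩
    · exact ⟨0, le_rfl, fun t ht => absurd (ht.1.trans ht.2) hse⟩
  · by_cases hse : s ≤ e
    swap
    · exact ⟨0, le_rfl, fun t ht => absurd (ht.1.trans ht.2) hse⟩
    have hse' := sub_nonneg.2 hse
    set R' := 2 * (|R| + 2 * M * (e - s)) with hR'
    have hR'0 : 0 ≤ R' := by positivity
    refine ⟨(2 * C : ℝ≥0) * (2 * (M + L * R')), by positivity, ?_⟩
    have key : ∀ t ∈ Icc s e, ∀ r ∈ Icc s e, t ≤ r → ∀ x,
        |g (Φ r x e) - g (Φ t x e)| ≤ (2 * C : ℝ≥0) * (2 * (M + L * R')) * |r - t| := by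
      intro t ht r hr htr x
      rw [abs_of_nonneg (sub_nonneg.2 htr)]
      by_cases hx : ‖x‖ ≤ R'
      · rw [hflow t ht r ⟨htr, hr.2⟩ x]
        have h1 := (hlip r hr).norm_sub_le x (Φ t x r)
        rw [Real.norm_eq_abs] at h1
        have h2 := hdisp t ht r ⟨htr, hr.2⟩ x
        rw [norm_sub_rev] at h2
        have hrt := sub_nonneg.2 htr
        rw [mul_assoc _ _ (r - t)]
        refine h1.trans (mul_le_mul_of_nonneg_left (h2.trans ?_) (by positivity))
        gcongr
      · rw [not_le] at hx
        rw [hsupp r hr x hx, hsupp t ht x hx, sub_self, abs_zero]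
        have hrt := sub_nonneg.2 htr
        positivity
    intro t ht r hr x
    rcases le_total t r with h | h
    · exact key t ht r hr h x
    · rw [abs_sub_comm, abs_sub_comm r t]
      exact key r hr t ht h x
  · intro t ht R₁ hR₁ ε hε
    have htI : t ∈ Icc s e := ⟨ht.1, ht.2.le⟩
    have hse' : 0 ≤ e - s := sub_nonneg.2 (ht.1.trans ht.2.le)
    -- a bound on the speed with which the characteristic leaves `y`
    set S := 2 * (M + L * (R₁ + (e - s) * R₁)) + R₁ with hS
    have hS0 : 0 ≤ S := by positivity
    have hη : 0 < ε / (2 * ((2 * C : ℝ≥0) + 1)) := by positivity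
    set η := ε / (2 * ((2 * C : ℝ≥0) + 1)) with hηdef
    have hcont := hb.continuous t htI η hη
    rw [eventually_nhdsWithin_iff, Metric.eventually_nhds_iff] at hcont
    obtain ⟨δ, hδ, hcont⟩ := hcont
    have hδ' : 0 < η / (L * S + 1) := by positivity
    filter_upwards [Ioo_mem_nhdsGT (show t < min e (t + min δ (η / (L * S + 1))) from
      lt_min ht.2 (by linarith [lt_min hδ hδ']))] with r hr y w hy hw
    have hre : r < e := hr.2.trans_le (min_le_left _ _)
    have hrI : r ∈ Icc s e := ⟨ht.1.trans hr.1.le, hre.le⟩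
    have hrt : 0 < r - t := sub_pos.2 hr.1
    have hr2 : r - t < min δ (η / (L * S + 1)) := by
      have := hr.2.trans_le (min_le_right _ _)
      linarith
    have hrδ : r - t < δ := hr2.trans_le (min_le_left _ _)
    have hrS : (r - t) * (L * S) ≤ η := by
      have h1 := (hr2.trans_le (min_le_right _ _))
      rw [lt_div_iff₀ (by positivity)] at h1
      nlinarith
    set z := y - (r - t) • w with hz
    have hyz : ‖y - z‖ ≤ (r - t) * R₁ := by
      rw [hz, sub_sub_cancel, norm_smul, Real.norm_of_nonneg hrt.le]
      gcongr
    have hzn : ‖z‖ ≤ R₁ + (e - s) * R₁ := by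
      have h1 := norm_sub_norm_le z y
      rw [norm_sub_rev z y] at h1
      have h2 : (r - t) * R₁ ≤ (e - s) * R₁ := by
        exact mul_le_mul_of_nonneg_right (by linarith [ht.1]) hR₁.le
      linarith
    have hspeed : ∀ q ∈ Icc t r, ‖b q (Φ t z q) - w‖ ≤ ‖b t y - w‖ + 2 * η := by
      intro q hq
      have hqe : q ∈ Icc t e := ⟨hq.1, hq.2.trans hre.le⟩
      have hqI : q ∈ Icc s e := ⟨ht.1.trans hq.1, hqe.2⟩
      have h1 : ‖b q (Φ t z q) - b t (Φ t z q)‖ ≤ η := by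
        refine hcont ?_ hqI _
        rw [Real.dist_eq, abs_of_nonneg (sub_nonneg.2 hq.1)]
        linarith [hq.2]
      have h2 : ‖b t (Φ t z q) - b t y‖ ≤ η := by
        have h3 := (hb.lipschitz t htI).norm_sub_le (Φ t z q) y
        have h4 : ‖Φ t z q - y‖ ≤ (r - t) * S := by
          have h5 := hdisp t htI q hqe z
          have h6 : 2 * (M + L * ‖z‖) * (q - t) ≤
              2 * (M + L * (R₁ + (e - s) * R₁)) * (r - t) := by
            have := sub_nonneg.2 hq.1
            gcongr
            exact hq.2
          have h7 := norm_sub_le_norm_sub_add_norm_sub (Φ t z q) z y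
          rw [norm_sub_rev z y] at h7
          have h8 : (r - t) * S =
              2 * (M + L * (R₁ + (e - s) * R₁)) * (r - t) + (r - t) * R₁ := by
            rw [hS]; ring
          linarith
        have h9 : L * ‖Φ t z q - y‖ ≤ L * ((r - t) * S) := by gcongr
        linarith
      have h3 := norm_sub_le_norm_sub_add_norm_sub (b q (Φ t z q)) (b t (Φ t z q)) w
      have h4 := norm_sub_le_norm_sub_add_norm_sub (b t (Φ t z q)) (b t y) w
      linarith
    have hmove := norm_sub_sub_smul_le_of_isIntegralCurveOn (hΦ t htI z) ⟨hr.1.le, hre.le⟩ hspeed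
    have hyr : y - Φ t z r = -(Φ t z r - Φ t z t - (r - t) • w) := by
      rw [hΦ₀ t htI, hz]; abel
    have h1 := (hlip r hrI).norm_sub_le y (Φ t z r)
    rw [Real.norm_eq_abs, hyr, norm_neg] at h1
    beta_reduce
    rw [hflow t htI r ⟨hr.1.le, hre.le⟩ z]
    refine h1.trans ?_
    have h2 : (2 * C : ℝ≥0) * (2 * η) ≤ ε := by
      rw [hηdef, mul_div_assoc', mul_div_assoc', div_le_iff₀ (by positivity)]
      nlinarith [(2 * C : ℝ≥0).2]
    calc ((2 * C : ℝ≥0) : ℝ) * ‖Φ t z r - Φ t z t - (r - t) • w‖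
        ≤ (2 * C : ℝ≥0) * ((‖b t y - w‖ + 2 * η) * (r - t)) := by gcongr
      _ = ((2 * C : ℝ≥0) * ‖b t y - w‖ + (2 * C : ℝ≥0) * (2 * η)) * (r - t) := by ring
      _ ≤ _ := by gcongr

/-- Finite measures are determined by the integrals of Lipschitz functions of bounded support. -/
lemma measure_ext_of_integral_lipschitz {ν ν' : Measure (Space d)} [IsFiniteMeasure ν]
    [IsFiniteMeasure ν'] (h : ∀ (g : Space d → ℝ) (C : ℝ≥0) (R : ℝ), LipschitzWith C g →
      (∀ x, R < ‖x‖ → g x = 0) → ∫ x, g x ∂ν = ∫ x, g x ∂ν') : ν = ν' := by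
  have hbdd : ∀ F : Set (Space d), IsClosed F → ∀ R : ℝ, ν (F ∩ Metric.closedBall 0 R) =
      ν' (F ∩ Metric.closedBall 0 R) := by
    intro F hF R
    have hc : IsClosed (F ∩ Metric.closedBall 0 R) := hF.inter Metric.isClosed_closedBall
    obtain ⟨δ, -, hpos, hlim⟩ := exists_seq_strictAnti_tendsto (0 : ℝ)
    have h1 := tendsto_integral_thickenedIndicator_of_isClosed ν hc hpos hlim
    have h2 := tendsto_integral_thickenedIndicator_of_isClosed ν' hc hpos hlim
    have heq : ∀ n, ∫ x, (thickenedIndicator (hpos n) (F ∩ Metric.closedBall 0 R) x : ℝ) ∂ν =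
        ∫ x, (thickenedIndicator (hpos n) (F ∩ Metric.closedBall 0 R) x : ℝ) ∂ν' := by
      intro n
      refine h _ _ (R + δ n) (LipschitzWith.of_dist_le_mul fun x y =>
        (lipschitzWith_thickenedIndicator (hpos n) _).dist_le_mul x y) fun x hx => ?_
      rw [thickenedIndicator_zero, NNReal.coe_zero]
      intro hmem
      obtain ⟨y, hy, hxy⟩ := Metric.mem_thickening_iff.1 hmem
      have hy2 : ‖y‖ ≤ R := by simpa using hy.2
      rw [dist_eq_norm] at hxy
      linarith [norm_le_norm_add_norm_sub' x y]
    simp only [heq] at h1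
    exact (measureReal_eq_measureReal_iff (measure_ne_top _ _) (measure_ne_top _ _)).1
      (tendsto_nhds_unique h1 h2)
  have hclosed : ∀ F : Set (Space d), IsClosed F → ν F = ν' F := by
    intro F hF
    have hmono : Monotone fun n : ℕ => F ∩ Metric.closedBall (0 : Space d) n := fun i j hij =>
      inter_subset_inter_right _ (Metric.closedBall_subset_closedBall (by exact_mod_cast hij))
    have hU : ⋃ n : ℕ, F ∩ Metric.closedBall (0 : Space d) n = F := by
      rw [← inter_iUnion, Metric.iUnion_closedBall_nat, inter_univ]
    have h1 := tendsto_measure_iUnion_atTop (μ := ν) hmono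
    have h2 := tendsto_measure_iUnion_atTop (μ := ν') hmono
    rw [hU] at h1 h2
    refine tendsto_nhds_unique (h1.congr fun n => ?_) h2
    exact hbdd F hF n
  refine ext_of_generate_finite {F | IsClosed F} ?_ isPiSystem_isClosed (fun F hF => hclosed F hF)
    (hclosed _ isClosed_univ)
  rw [BorelSpace.measurable_eq (α := Space d), borel_eq_generateFrom_isClosed]

lemma IsWeakSolutionOn.mono (hμ : IsWeakSolutionOn μ b m s e) {t r : ℝ} (ht : s ≤ t) (hr : r ≤ e) :
    IsWeakSolutionOn μ b m t r :=
  have hsub : Icc t r ⊆ Icc s e := Icc_subset_Icc ht hr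
  { finite := fun q hq => hμ.finite q (hsub hq)
    mass_le := fun q hq => hμ.mass_le q (hsub hq)
    continuousOn := fun g hg hs => (hμ.continuousOn g hg hs).mono hsub
    weak := fun φ hφ hs q hq q' hq' => hμ.weak φ hφ hs q (hsub hq) q' (hsub hq') }

/-- A family of characteristics started at time `s`, one through each point. -/
structure IsCharacteristicFlow (γ : Space d → ℝ → Space d) (b : ℝ → Space d → Space d)
    (s e : ℝ) : Prop where
  initial : ∀ x, γ x s = x
  curve : ∀ x, IsIntegralCurveOn (γ x) b (Icc s e)

lemma IsCharacteristicFlow.mono {γ : Space d → ℝ → Space d} (hγ : IsCharacteristicFlow γ b s e)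
    {t : ℝ} (ht : t ≤ e) : IsCharacteristicFlow γ b s t :=
  ⟨hγ.initial, fun x q hq => (hγ.curve x q ⟨hq.1, hq.2.trans ht⟩).mono (Icc_subset_Icc_right ht)⟩

lemma IsShortTimeField.exists_isCharacteristicFlow (hb : IsShortTimeField b L s e) (hse : s ≤ e) :
    ∃ γ, IsCharacteristicFlow γ b s e := by
  choose γ h0 h using hb.exists_isIntegralCurveOn hse
  exact ⟨γ, h0, h⟩

lemma IsCharacteristicFlow.continuous {γ : Space d → ℝ → Space d}
    (hγ : IsCharacteristicFlow γ b s e) (hb : IsShortTimeField b L s e) {t : ℝ}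
    (ht : t ∈ Icc s e) : Continuous fun x => γ x t := by
  refine (LipschitzWith.of_dist_le_mul (K := 2) fun x y => ?_).continuous
  have h := hb.norm_sub_le_two_mul (hγ.curve x) (hγ.curve y) ht
  rwa [hγ.initial, hγ.initial] at h

/-- Weak solutions with a given Lipschitz field are unique: they are the push-forward of the initial
measure along the characteristics. -/
theorem IsWeakSolutionOn.eq_map (hμ : IsWeakSolutionOn μ b m s e) (hb : IsShortTimeField b L s e)
    {γ : Space d → ℝ → Space d} (hγ : IsCharacteristicFlow γ b s e) {t : ℝ} (ht : t ∈ Icc s e) :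
    μ t = (μ s).map fun x => γ x t := by
  replace hμ := hμ.mono le_rfl ht.2
  replace hb := hb.mono le_rfl ht.2
  replace hγ := hγ.mono ht.2
  have hst := ht.1
  clear ht
  have hs : s ∈ Icc s t := ⟨le_rfl, hst⟩
  have ht : t ∈ Icc s t := ⟨hst, le_rfl⟩
  have hex : ∀ q ∈ Icc s t, ∃ Φ : Space d → ℝ → Space d, IsCharacteristicFlow Φ b q t :=
    fun q hq => (hb.mono hq.1 le_rfl).exists_isCharacteristicFlow hq.2
  choose! Φ hΦ using hex
  have := hμ.finite s hs
  have := hμ.finite t ht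
  refine measure_ext_of_integral_lipschitz fun g C R hg hR => ?_
  have hkey := hμ.integral_eq (isLipschitzTransport_comp hb
    (fun q hq => (hΦ q hq).initial) (fun q hq => (hΦ q hq).curve) hg hR) hb hst
  simp only [(hΦ t ht).initial] at hkey
  rw [hkey, integral_map (hγ.continuous hb ht).measurable.aemeasurable
    hg.continuous.aestronglyMeasurable]
  refine integral_congr_ae (ae_of_all _ fun x => ?_)
  have h := hb.norm_sub_le_two_mul ((hΦ s hs).curve x) (hγ.curve x) ht
  rw [(hΦ s hs).initial, hγ.initial, sub_self, norm_zero, mul_zero] at h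
  change g _ = g _
  rw [eq_of_sub_eq_zero (norm_le_zero_iff.1 h)]

end Representation

/-! ### Stability of solutions in `W1` -/

section Stability

variable {d N : ℕ} {T : ℝ} {vd K : Space d → Space d} {Lv k L : ℝ≥0}

lemma IsSolution.isLipschitzField {μ₀ : Measure (Space d)} {μ : ℝ → Measure (Space d)}
    (h : IsSolution N T vd K μ₀ μ) (hvd : LipschitzWith Lv vd) (hK : LipschitzWith k K)
    (hL : Lv + N * k ≤ L) : IsLipschitzField (fun t => velocity vd K (μ t)) L 0 T where
  lipschitz t ht := (lipschitzWith_velocity hvd hK (h.mem t ht)).weaken hL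
  continuous t ht ε hε := by
    have hη : 0 < ε / (k + 1) := by positivity
    filter_upwards [(h.continuous t ht).eventually_lt_const (ENNReal.ofReal_pos.2 hη),
      self_mem_nhdsWithin] with r hr hrI x
    refine (norm_velocity_sub_velocity_le hK (h.mem r hrI) (h.mem t ht) hη.le hr.le x).trans ?_
    rw [mul_div_assoc', div_le_iff₀ (by positivity)]
    nlinarith

lemma IsSolution.isWeakSolutionOn {μ₀ : Measure (Space d)} {μ : ℝ → Measure (Space d)}
    (h : IsSolution N T vd K μ₀ μ) (hvd : LipschitzWith Lv vd) (hK : LipschitzWith k K) :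
    IsWeakSolutionOn μ (fun t => velocity vd K (μ t)) N 0 T :=
  have hcurve : IsContinuousCurve μ N 0 T :=
    { finite := fun t ht => isFiniteMeasure_of_mem_massMeasures (h.mem t ht)
      mass_le := fun t ht => (real_univ_of_mem_massMeasures (h.mem t ht)).le
      continuousOn := fun g hg hs t ht => tendsto_integral_of_tendsto_W1
        (eventually_nhdsWithin_of_forall h.mem) (h.mem t ht) (h.continuous t ht) hg hs }
  { hcurve with
    weak := fun φ hφ hs t ht r hr => by
      have hc := hcurve.continuousOn_flux (h.isLipschitzField hvd hK le_rfl) hφ hs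
      have hint : ∀ q ∈ Icc (0 : ℝ) T, IntervalIntegrable
          (fun q => ∫ x, fderiv ℝ φ x (velocity vd K (μ q) x) ∂(μ q)) volume 0 q := fun q hq =>
        (hc.mono (by rw [uIcc_of_le hq.1]; exact Icc_subset_Icc_right hq.2)).intervalIntegrable
      rw [h.weak φ hφ hs t ht, h.weak φ hφ hs r hr, add_sub_add_left_eq_sub,
        intervalIntegral.integral_interval_sub_left (hint r hr) (hint t ht)] }

/-- A transport plan pushed forward by a map in each factor is a plan between the push-forwards. -/
lemma W1_map_le {μ ν : Measure (Space d)} {π : Measure (Space d × Space d)}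
    (hπ : π ∈ transferencePlans μ ν) {f g : Space d → Space d} (hf : Continuous f)
    (hg : Continuous g) :
    W1 (μ.map f) (ν.map g) ≤ ∫⁻ p, ENNReal.ofReal ‖f p.1 - g p.2‖ ∂π := by
  have hfm := hf.measurable
  have hgm := hg.measurable
  have hfg : Measurable fun p : Space d × Space d => (f p.1, g p.2) := by fun_prop
  have hmem : π.map (fun p => (f p.1, g p.2)) ∈ transferencePlans (μ.map f) (ν.map g) := by
    constructor
    · rw [Measure.map_map measurable_fst hfg, ← hπ.1, Measure.map_map hfm measurable_fst]
      rfl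
    · rw [Measure.map_map measurable_snd hfg, ← hπ.2, Measure.map_map hgm measurable_snd]
      rfl
  refine (iInf₂_le _ hmem).trans_eq ?_
  rw [lintegral_map (by fun_prop) hfg]

variable {μ₀ ν₀ : Measure (Space d)} {μ ν : ℝ → Measure (Space d)}

/-- The distance of two solutions stays bounded on a short time interval: characteristics move
points by at most a linear function of their norm, and a plan of finite cost is transported. -/
lemma exists_W1_le_of_W1_ne_top (hμ : IsSolution N T vd K μ₀ μ) (hν : IsSolution N T vd K ν₀ ν)
    {s e : ℝ} (hs : 0 ≤ s) (hse : s ≤ e) (he : e ≤ T) {b b' : ℝ → Space d → Space d}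
    (hb : IsShortTimeField b L s e) (hb' : IsShortTimeField b' L s e)
    {γ γ' : Space d → ℝ → Space d} (hγ : IsCharacteristicFlow γ b s e)
    (hγ' : IsCharacteristicFlow γ' b' s e) (hμγ : ∀ t ∈ Icc s e, μ t = (μ s).map fun x => γ x t)
    (hνγ : ∀ t ∈ Icc s e, ν t = (ν s).map fun x => γ' x t) (hfin : W1 (μ s) (ν s) ≠ ⊤) :
    ∃ B : ℝ≥0∞, B ≠ ⊤ ∧ ∀ t ∈ Icc s e, W1 (μ t) (ν t) ≤ B := by
  have hsI : s ∈ Icc 0 T := ⟨hs, hse.trans he⟩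
  have hlt := hfin.lt_top
  simp only [W1, iInf_lt_iff] at hlt
  obtain ⟨π, hπ, -⟩ := hlt
  have := isFiniteMeasure_of_mem_massMeasures (hμ.mem s hsI)
  have := transferencePlans_isFiniteMeasure hπ
  obtain ⟨M, hM0, hM⟩ := hb.exists_bound
  obtain ⟨M', hM'0, hM'⟩ := hb'.exists_bound
  have hdisp : ∀ {b : ℝ → Space d → Space d} {γ : Space d → ℝ → Space d} {M : ℝ},
      IsShortTimeField b L s e → IsCharacteristicFlow γ b s e → 0 ≤ M →
      (∀ t ∈ Icc s e, ∀ x, ‖b t x‖ ≤ M + L * ‖x‖) → ∀ t ∈ Icc s e, ∀ x,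
      ‖γ x t‖ ≤ 2 * M * (e - s) + 2 * ‖x‖ := by
    intro b γ M hb hγ hM0 hM t ht x
    have h1 := hb.norm_sub_initial_le (hγ.curve x) hM ht
    rw [hγ.initial] at h1
    have h2 : 2 * (M + L * ‖x‖) * (t - s) ≤ 2 * (M + L * ‖x‖) * (e - s) := by
      gcongr; exact ht.2
    have h3 : L * (e - s) * ‖x‖ ≤ 1 / 4 * ‖x‖ := by
      gcongr; exact hb.short
    have h4 := norm_le_norm_add_norm_sub' (γ x t) x
    linarith [norm_nonneg x]
  have hint : Integrable (fun p : Space d × Space d => (2 * M * (e - s) + 2 * ‖p.1‖) +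
      (2 * M' * (e - s) + 2 * ‖p.2‖)) π :=
    ((integrable_const _).add ((integrable_fst_of_mem_transferencePlans hπ continuous_norm
      (integrable_norm_of_mem_massMeasures (hμ.mem s hsI))).const_mul 2)).add
    ((integrable_const _).add ((integrable_snd_of_mem_transferencePlans hπ continuous_norm
      (integrable_norm_of_mem_massMeasures (hν.mem s hsI))).const_mul 2))
  refine ⟨_, hint.lintegral_lt_top.ne, fun t ht => ?_⟩
  rw [hμγ t ht, hνγ t ht]
  refine (W1_map_le hπ (hγ.continuous hb ht) (hγ'.continuous hb' ht)).trans ?_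
  refine lintegral_mono fun p => ENNReal.ofReal_le_ofReal ?_
  exact (norm_sub_le _ _).trans
    (add_le_add (hdisp hb hγ hM0 hM t ht p.1) (hdisp hb' hγ' hM'0 hM' t ht p.2))

/-- Stability on a short time interval. Transporting a plan along both families of characteristics
bounds the distance at time `t` by twice the cost of the plan plus half of the supremum of the
distance over the interval, and the latter is absorbed. -/
lemma W1_le_four_mul (hμ : IsSolution N T vd K μ₀ μ) (hν : IsSolution N T vd K ν₀ ν)
    (hvd : LipschitzWith Lv vd) (hK : LipschitzWith k K) (hL : Lv + N * k ≤ L)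
    {s e : ℝ} (hs : 0 ≤ s) (hse : s ≤ e) (he : e ≤ T) (hshort : L * (e - s) ≤ 1 / 4) :
    W1 (μ e) (ν e) ≤ 4 * W1 (μ s) (ν s) := by
  by_cases hfin : W1 (μ s) (ν s) = ⊤
  · rw [hfin, ENNReal.mul_top (by norm_num)]
    exact le_top
  have hsub : Icc s e ⊆ Icc 0 T := Icc_subset_Icc hs he
  have hfield : ∀ {μ₀ : Measure (Space d)} {μ : ℝ → Measure (Space d)},
      IsSolution N T vd K μ₀ μ → IsShortTimeField (fun t => velocity vd K (μ t)) L s e :=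
    fun h => ⟨⟨fun t ht => (h.isLipschitzField hvd hK hL).lipschitz t (hsub ht),
      fun t ht ε hε => ((h.isLipschitzField hvd hK hL).continuous t (hsub ht) ε hε).filter_mono
        (nhdsWithin_mono _ hsub)⟩, hshort⟩
  have hb := hfield hμ
  have hb' := hfield hν
  obtain ⟨γ, hγ⟩ := hb.exists_isCharacteristicFlow hse
  obtain ⟨γ', hγ'⟩ := hb'.exists_isCharacteristicFlow hse
  have hμγ : ∀ t ∈ Icc s e, μ t = (μ s).map fun x => γ x t := fun t ht =>
    ((hμ.isWeakSolutionOn hvd hK).mono hs he).eq_map hb hγ ht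
  have hνγ : ∀ t ∈ Icc s e, ν t = (ν s).map fun x => γ' x t := fun t ht =>
    ((hν.isWeakSolutionOn hvd hK).mono hs he).eq_map hb' hγ' ht
  obtain ⟨B, hB, hWB⟩ := exists_W1_le_of_W1_ne_top hμ hν hs hse he hb hb' hγ hγ' hμγ hνγ hfin
  set W := ⨆ t ∈ Icc s e, W1 (μ t) (ν t) with hW
  have hWtop : W ≠ ⊤ := ne_top_of_le_ne_top hB (iSup₂_le hWB)
  have hle : ∀ t ∈ Icc s e, W1 (μ t) (ν t) ≤ W := fun t ht => le_iSup₂_of_le t ht le_rfl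
  have hNk : (N : ℝ) * k * (e - s) ≤ 1 / 4 := by
    refine le_trans (mul_le_mul_of_nonneg_right ?_ (sub_nonneg.2 hse)) hshort
    have : ((Lv + N * k : ℝ≥0) : ℝ) ≤ L := by exact_mod_cast hL
    push_cast at this
    linarith [Lv.2]
  -- the two velocities differ by at most `k W` on the whole interval
  have hpoint : ∀ t ∈ Icc s e, ∀ x y, ‖γ x t - γ' y t‖ ≤
      2 * ‖x - y‖ + 2 * (k * W.toReal * (e - s)) := by
    intro t ht x y
    have h := hb.norm_sub_le (hγ.curve x) (hγ'.curve y) (η := k * W.toReal) (by positivity)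
      (fun r hr => by
        rw [norm_sub_rev]
        exact norm_velocity_sub_velocity_le hK (hμ.mem r (hsub hr)) (hν.mem r (hsub hr))
          ENNReal.toReal_nonneg ((hle r hr).trans_eq (ENNReal.ofReal_toReal hWtop).symm) _) ht
    rw [hγ.initial, hγ'.initial] at h
    have h1 : k * W.toReal * (t - s) ≤ k * W.toReal * (e - s) := by
      gcongr; exact ht.2
    linarith
  have hplan : ∀ t ∈ Icc s e, ∀ π ∈ transferencePlans (μ s) (ν s),
      W1 (μ t) (ν t) ≤ 2 * (∫⁻ p, ENNReal.ofReal ‖p.1 - p.2‖ ∂π) + W / 2 := by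
    intro t ht π hπ
    have hmass : π univ = N := by
      rw [← (hμ.mem s (hsub ⟨le_rfl, hse⟩)).1, ← hπ.1, Measure.map_apply measurable_fst .univ,
        preimage_univ]
    rw [hμγ t ht, hνγ t ht]
    refine (W1_map_le hπ (hγ.continuous hb ht) (hγ'.continuous hb' ht)).trans ?_
    calc ∫⁻ p, ENNReal.ofReal ‖γ p.1 t - γ' p.2 t‖ ∂π
        ≤ ∫⁻ p, (2 * ENNReal.ofReal ‖p.1 - p.2‖ +
            ENNReal.ofReal (2 * (k * W.toReal * (e - s)))) ∂π := by
          refine lintegral_mono fun p => ?_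
          refine (ENNReal.ofReal_le_ofReal (hpoint t ht p.1 p.2)).trans
            (ENNReal.ofReal_add_le.trans_eq ?_)
          rw [ENNReal.ofReal_mul (by norm_num), ENNReal.ofReal_ofNat]
      _ = 2 * (∫⁻ p, ENNReal.ofReal ‖p.1 - p.2‖ ∂π) +
            ENNReal.ofReal (2 * (k * W.toReal * (e - s))) * N := by
          rw [lintegral_add_right _ measurable_const, lintegral_const, hmass,
            lintegral_const_mul _ (by fun_prop)]
      _ ≤ _ := by
          gcongr
          rw [← ENNReal.ofReal_natCast, ← ENNReal.ofReal_mul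
            (by have := sub_nonneg.2 hse; positivity)]
          calc ENNReal.ofReal (2 * (k * W.toReal * (e - s)) * N)
              ≤ ENNReal.ofReal (W.toReal / 2) := by
                refine ENNReal.ofReal_le_ofReal ?_
                have := mul_le_mul_of_nonneg_right hNk (ENNReal.toReal_nonneg (a := W))
                linarith
            _ = W / 2 := by
                rw [ENNReal.ofReal_div_of_pos (by norm_num), ENNReal.ofReal_toReal hWtop,
                  ENNReal.ofReal_ofNat]
  have hstep : ∀ t ∈ Icc s e, W1 (μ t) (ν t) ≤ 2 * W1 (μ s) (ν s) + W / 2 := by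
    intro t ht
    have hdef : W1 (μ s) (ν s) = ⨅ π ∈ transferencePlans (μ s) (ν s),
      ∫⁻ p, ENNReal.ofReal ‖p.1 - p.2‖ ∂π := rfl
    rw [hdef, ENNReal.mul_iInf_of_ne (by norm_num) (by norm_num), ENNReal.iInf_add]
    refine le_iInf fun π => ?_
    by_cases hπ : π ∈ transferencePlans (μ s) (ν s)
    · simpa [hπ] using hplan t ht π hπ
    · simp [hπ]
  have hWle : W ≤ 2 * W1 (μ s) (ν s) + W / 2 := iSup₂_le hstep
  have hhalf : W / 2 ≤ 2 * W1 (μ s) (ν s) := by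
    -- the term `W / 2` can be cancelled only because `W` is finite
    have h2 : W / 2 ≠ ⊤ := ENNReal.div_ne_top hWtop (by norm_num)
    exact (ENNReal.add_le_add_iff_right h2).1 ((ENNReal.add_halves W).le.trans hWle)
  refine (hle e ⟨hse, le_rfl⟩).trans ?_
  calc W = W / 2 + W / 2 := (ENNReal.add_halves W).symm
    _ ≤ 2 * W1 (μ s) (ν s) + 2 * W1 (μ s) (ν s) := add_le_add hhalf hhalf
    _ = 4 * W1 (μ s) (ν s) := by rw [← add_mul]; norm_num

/-- Stability on `[0, T]`, by chaining `n` short intervals. The constant depends only on `T` and on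
the Lipschitz constant `L` of the velocity. -/
theorem W1_le_four_pow_mul (hμ : IsSolution N T vd K μ₀ μ) (hν : IsSolution N T vd K ν₀ ν)
    (hvd : LipschitzWith Lv vd) (hK : LipschitzWith k K) (hL : Lv + N * k ≤ L) {n : ℕ}
    (hn : 0 < n) (hLn : 4 * (L * T) ≤ n) {t : ℝ} (ht : t ∈ Icc 0 T) :
    W1 (μ t) (ν t) ≤ 4 ^ n * W1 μ₀ ν₀ := by
  have hn' : (0 : ℝ) < n := by exact_mod_cast hn
  have key : ∀ j : ℕ, j ≤ n → W1 (μ (j * (t / n))) (ν (j * (t / n))) ≤ 4 ^ j * W1 μ₀ ν₀ := by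
    intro j
    induction j with
    | zero => simp [hμ.initial, hν.initial]
    | succ j ih =>
      intro hj
      have htn : 0 ≤ t / n := div_nonneg ht.1 hn'.le
      have hdiff : ((j + 1 : ℕ) : ℝ) * (t / n) - j * (t / n) = t / n := by push_cast; ring
      refine (W1_le_four_mul hμ hν hvd hK hL (s := j * (t / n)) (by positivity)
        (by linarith) ?_ ?_).trans ?_
      · have h1 : ((j + 1 : ℕ) : ℝ) * (t / n) ≤ n * (t / n) := by gcongr
        rw [mul_div_cancel₀ _ hn'.ne'] at h1
        exact h1.trans ht.2
      · rw [hdiff, mul_div_assoc', div_le_iff₀ hn']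
        have : L * t ≤ L * T := by gcongr; exact ht.2
        linarith
      · rw [pow_succ', mul_assoc]
        gcongr
        exact ih (by omega)
  have h := key n le_rfl
  rwa [mul_div_cancel₀ _ hn'.ne'] at h

end Stability

/-! ### The initial data and the scaled kernel -/

section InitialData

variable {d N : ℕ}

lemma IsProfile.eq_zero {f : Space d → ℝ} (hf : IsProfile f) {x : Space d} (hx : 1 < ‖x‖) :
    f x = 0 := by
  by_contra h
  have := hf.support (subset_tsupport f h)
  rw [Metric.mem_closedBall, dist_zero_right] at this
  linarith

lemma IsProfile.integrable_and_integral_eq_one {f : Space d → ℝ} (hf : IsProfile f) :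
    Integrable f ∧ ∫ x, f x = 1 := by
  have hae : Metric.ball (0 : Space d) 1 =ᵐ[volume] Metric.closedBall (0 : Space d) 1 := by
    rw [← Metric.ball_union_sphere]
    exact (union_ae_eq_left_of_ae_eq_empty (ae_eq_empty.2
      (Measure.addHaar_sphere_of_ne_zero volume 0 one_ne_zero))).symm
  -- a non-integrable function has integral `0`, so unit mass forces integrability
  have hball : IntegrableOn f (Metric.ball 0 1) := by
    by_contra h
    have := hf.mass
    rw [integral_undef h] at this
    exact zero_ne_one this
  refine ⟨(integrableOn_iff_integrable_of_support_subset ((subset_tsupport f).trans hf.support)).1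
    (hball.congr_set_ae hae.symm), ?_⟩
  rw [← setIntegral_eq_integral_of_forall_compl_eq_zero (s := Metric.closedBall 0 1)
    fun x hx => hf.eq_zero (by simpa using hx), ← setIntegral_congr_set hae, hf.mass]

/-- The rescaled profile around `c` is a probability density. -/
lemma IsProfile.integrable_and_lintegral_rescaled {f : Space d → ℝ} (hf : IsProfile f) {r : ℝ}
    (hr : 0 < r) (c : Space d) :
    Integrable (fun x => (1 / r ^ d) * f ((1 / r) • (x - c))) ∧
      ∫⁻ x, ENNReal.ofReal ((1 / r ^ d) * f ((1 / r) • (x - c))) = 1 := by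
  obtain ⟨hi, h1⟩ := hf.integrable_and_integral_eq_one
  have hi' : Integrable (fun x => (1 / r ^ d) * f ((1 / r) • (x - c))) :=
    ((hi.comp_smul (one_div_pos.2 hr).ne').comp_sub_right c).const_mul _
  refine ⟨hi', ?_⟩
  rw [← ofReal_integral_eq_lintegral_ofReal hi'
    (ae_of_all _ fun x => mul_nonneg (by positivity) (hf.nonneg _)), integral_const_mul,
    integral_sub_right_eq_self (fun x => f ((1 / r) • x)) c, Measure.integral_comp_smul, h1,
    finrank_euclideanSpace_fin, abs_of_nonneg (by positivity)]
  simp [hr.ne']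

/-- Moving the unit mass spread over the ball of radius `r` around each `X i` to its centre costs at
most `r`. -/
lemma W1_discreteDatum_continuousDatum_le {f : Space d → ℝ} (hf : IsProfile f) {r : ℝ}
    (hr : 0 < r) (X : Fin N → Space d) :
    W1 (discreteDatum X) (continuousDatum f r X) ≤ N * ENNReal.ofReal r := by
  set g : Fin N → Space d → ℝ≥0∞ := fun i x =>
    ENNReal.ofReal ((1 / r ^ d) * f ((1 / r) • (x - X i))) with hg
  have hgm : ∀ i, AEMeasurable (g i) := fun i =>
    (hf.integrable_and_lintegral_rescaled hr (X i)).1.aemeasurable.ennreal_ofReal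
  have hg1 : ∀ i, ∫⁻ x, g i x = 1 := fun i => (hf.integrable_and_lintegral_rescaled hr (X i)).2
  have hρ : continuousDatum f r X = ∑ i, volume.withDensity (g i) := by
    ext A hA
    rw [continuousDatum, withDensity_apply _ hA, Measure.finsetSum_apply]
    simp_rw [withDensity_apply _ hA]
    rw [← lintegral_finsetSum' _ fun i _ => (hgm i).restrict]
    refine lintegral_congr fun x => ?_
    exact ENNReal.ofReal_sum_of_nonneg fun i _ => mul_nonneg (by positivity) (hf.nonneg _)
  have hmass : ∀ i, IsProbabilityMeasure ((volume : Measure (Space d)).withDensity (g i)) :=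
    fun i => ⟨by rw [withDensity_apply _ .univ, setLIntegral_univ, hg1]⟩
  have hmem : (∑ i, (Measure.dirac (X i)).prod (volume.withDensity (g i))) ∈
      transferencePlans (discreteDatum X) (continuousDatum f r X) := by
    constructor
    · rw [Measure.map_finset_sum' measurable_fst.aemeasurable, discreteDatum]
      refine Finset.sum_congr rfl fun i _ => ?_
      rw [Measure.map_fst_prod, measure_univ, one_smul]
    · rw [Measure.map_finset_sum' measurable_snd.aemeasurable, hρ]
      refine Finset.sum_congr rfl fun i _ => ?_
      rw [Measure.map_snd_prod, measure_univ, one_smul]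
  refine (iInf₂_le _ hmem).trans ?_
  · rw [lintegral_finsetSum_measure]
    have hi : ∀ i, ∫⁻ p, ENNReal.ofReal ‖p.1 - p.2‖
        ∂((Measure.dirac (X i)).prod (volume.withDensity (g i))) ≤ ENNReal.ofReal r := by
      intro i
      rw [Measure.dirac_prod, lintegral_map (by fun_prop) (by fun_prop),
        lintegral_withDensity_eq_lintegral_mul₀ (hgm i) (by fun_prop)]
      calc ∫⁻ y, (g i * fun y => ENNReal.ofReal ‖X i - y‖) y
          ≤ ∫⁻ y, g i y * ENNReal.ofReal r := by
            refine lintegral_mono fun y => ?_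
            by_cases hy : ‖X i - y‖ ≤ r
            · exact mul_le_mul_right (ENNReal.ofReal_le_ofReal hy) _
            · have h0 : f ((1 / r) • (y - X i)) = 0 := by
                refine hf.eq_zero ?_
                rw [norm_smul, Real.norm_of_nonneg (by positivity), norm_sub_rev, one_div,
                  ← div_eq_inv_mul, one_lt_div hr]
                exact not_le.1 hy
              have h1 : g i y = 0 := by
                change ENNReal.ofReal (_ * f ((1 / r) • (y - X i))) = 0
                rw [h0, mul_zero, ENNReal.ofReal_zero]
              simp [h1]
        _ = ENNReal.ofReal r := by
            rw [lintegral_mul_const'' _ (hgm i), hg1, one_mul]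
    exact (Finset.sum_le_sum fun i _ => hi i).trans_eq (by simp)

/-- For `α + β ≥ 1` the scaled kernel has Lipschitz constant at most `LK / N`, so that the velocity
generated by a measure of mass `N` is Lipschitz uniformly in `N`. -/
lemma exists_lipschitzWith_scaledKernel {𝒦 : Space d → Space d} {LK : ℝ≥0}
    (h𝒦 : LipschitzWith LK 𝒦) {α β : ℝ} (hαβ : 1 ≤ α + β) (hN : 1 ≤ N) :
    ∃ k : ℝ≥0, LipschitzWith k (scaledKernel 𝒦 α β N) ∧ N * k ≤ LK := by
  have hN' : (1 : ℝ) ≤ N := by exact_mod_cast hN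
  have hN0 : (0 : ℝ) < N := by positivity
  refine ⟨LK / N, ?_, ?_⟩
  · refine LipschitzWith.of_dist_le_mul fun x y => ?_
    rw [dist_eq_norm, dist_eq_norm, scaledKernel, scaledKernel, ← smul_sub, norm_smul,
      Real.norm_of_nonneg (by positivity)]
    have h1 := h𝒦.norm_sub_le ((1 / (N : ℝ) ^ β) • x) ((1 / (N : ℝ) ^ β) • y)
    rw [← smul_sub, norm_smul, Real.norm_of_nonneg (by positivity)] at h1
    have h2 : 1 / (N : ℝ) ^ α * (1 / (N : ℝ) ^ β) ≤ 1 / N := by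
      rw [one_div_mul_one_div, ← Real.rpow_add hN0]
      refine one_div_le_one_div_of_le hN0 ?_
      simpa using Real.rpow_le_rpow_of_exponent_le hN' hαβ
    push_cast
    calc 1 / (N : ℝ) ^ α * ‖𝒦 ((1 / (N : ℝ) ^ β) • x) - 𝒦 ((1 / (N : ℝ) ^ β) • y)‖
        ≤ 1 / (N : ℝ) ^ α * (LK * (1 / (N : ℝ) ^ β * ‖x - y‖)) := by gcongr
      _ = LK * (1 / (N : ℝ) ^ α * (1 / (N : ℝ) ^ β)) * ‖x - y‖ := by ring
      _ ≤ LK * (1 / N) * ‖x - y‖ := by gcongr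
      _ = LK / N * ‖x - y‖ := by ring
  · rw [mul_div_cancel₀ _ (by positivity)]

end InitialData

end CrowdDynamics

end

theorem mainTheorem1 {d : ℕ} {T : ℝ} (hT : 0 < T)
    -- Lipschitz desired velocity and interaction profile
    {vd 𝒦 : CrowdDynamics.Space d → CrowdDynamics.Space d} {Lv LK : ℝ≥0}
    (hvd : LipschitzWith Lv vd) (h𝒦 : LipschitzWith LK 𝒦)
    {α β : ℝ} (hαβ : 1 ≤ α + β)
    -- bump profile, initial positions and radii
    {f : CrowdDynamics.Space d → ℝ} (hf : CrowdDynamics.IsProfile f)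
    (X : (N : ℕ) → Fin N → CrowdDynamics.Space d) (r : ℕ → ℝ)
    (hr_pos : ∀ N : ℕ, 1 ≤ N → 0 < r N)
    (hX : ∀ N : ℕ, 1 ≤ N → ∀ i j : Fin N, i ≠ j → X N i ≠ X N j)
    (hr_sep : ∀ N : ℕ, 1 ≤ N → ∀ i j : Fin N, i ≠ j → r N < 1 / 2 * ‖X N j - X N i‖)
    (hr : r =o[atTop] fun N : ℕ => (1 : ℝ) / N)
    -- the discrete and continuous solutions of the Cauchy problem
    (ε ρ : ℕ → ℝ → Measure (CrowdDynamics.Space d))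
    (hε : ∀ N : ℕ, 1 ≤ N →
      CrowdDynamics.IsSolution N T vd (CrowdDynamics.scaledKernel 𝒦 α β N)
        (CrowdDynamics.discreteDatum (X N)) (ε N))
    (hρ : ∀ N : ℕ, 1 ≤ N →
      CrowdDynamics.IsSolution N T vd (CrowdDynamics.scaledKernel 𝒦 α β N)
        (CrowdDynamics.continuousDatum f (r N) (X N)) (ρ N)) :
    ∀ t ∈ Ioc 0 T,
      Tendsto (fun N : ℕ => CrowdDynamics.W1 (ε N t) (ρ N t)) atTop (𝓝 0) := by
  intro t ht
  -- the number of short intervals does not depend on `N`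
  obtain ⟨n, hn⟩ := exists_nat_ge (4 * (((Lv + LK : ℝ≥0) : ℝ) * T) + 1)
  have hn0 : 0 < n := by
    have : (0 : ℝ) < n := by
      have : 0 ≤ ((Lv + LK : ℝ≥0) : ℝ) * T := by positivity
      linarith
    exact_mod_cast this
  have hlim : Tendsto (fun N : ℕ => 4 ^ n * ENNReal.ofReal (r N / (1 / N))) atTop (𝓝 0) := by
    have h1 := ENNReal.Tendsto.const_mul (a := 4 ^ n)
      (ENNReal.tendsto_ofReal hr.tendsto_div_nhds_zero)
      (Or.inr (ENNReal.pow_ne_top (by norm_num)))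
    simpa using h1
  refine tendsto_of_tendsto_of_tendsto_of_le_of_le' tendsto_const_nhds hlim
    (Eventually.of_forall fun _ => zero_le) ?_
  filter_upwards [eventually_ge_atTop 1] with N hN
  obtain ⟨k, hk, hNk⟩ := CrowdDynamics.exists_lipschitzWith_scaledKernel h𝒦 hαβ hN
  refine (CrowdDynamics.W1_le_four_pow_mul (hε N hN) (hρ N hN) hvd hk
    (L := Lv + LK) (by gcongr) hn0 (by linarith) (Ioc_subset_Icc_self ht)).trans ?_
  gcongr
  refine (CrowdDynamics.W1_discreteDatum_continuousDatum_le hf (hr_pos N hN) (X N)).trans_eq ?_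
  rw [← ENNReal.ofReal_natCast, ← ENNReal.ofReal_mul (by positivity), div_div_eq_mul_div, div_one,
    mul_comm]
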